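/- Conventions. A tensor triangulated category $\mathcal K$ is a triangulated category with suspension $\Sigma$ and a symmetric monoidal structure $(\otimes,\mathbb 1)$ that is exact in each variable, with natural isomorphisms $\Sigma^n X\otimes Y\cong\Sigma^n(X\otimes Y)\cong X\otimes\Sigma^nY$ compatible with the symmetric monoidal structure, the two resulting isomorphisms $\Sigma^mX\otimes\Sigma^nY\cong\Sigma^{m+n}(X\otimes Y)$ differing by the sign $(-1)^{mn}$. For an object $X$, a graded endomorphism of degree $i\in\mathbb Z$ is a morphism $f:\Sigma^iX\to X$; it is $\otimes$-balanced if $f\otimes X=X\otimes f$ as graded endomorphisms of $X\otimes X$. Let $\Phi$ be a non-empty collection of objects of $\mathcal K$ closed under $\otimes$. The graded-commutative $\mathbb Z$-graded ring $R^\bullet_{\mathcal K,\Phi}$ has as its degree $i$ part the set of pairs $(X,f)$ with $X\in\Phi$ and $f$ a $\otimes$-balanced graded endomorphism of $X$ of degree $i$, modulo the smallest equivalence relation with $(X,f)\sim(a\otimes X,a\otimes f)$ and $(X,f)\sim(X\otimes a,f\otimes a)$ for all $a\in\Phi$; the class of $(X,f)$ is $[f]$, and for $f$ on $X$ and $g$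 on $Y$ one puts $[f]+[g]=[f\otimes Y+X\otimes g]$ (for equal degrees) and $[f][g]=[(f\otimes Y)\circ(X\otimes g)]$ (graded composition). $\mathrm{Spc}(\mathcal K)$ is the space of primes of $\mathcal K$, that is, of proper thick $\otimes$-ideals $\mathcal P$ such that $X\otimes Y\in\mathcal P$ implies $X\in\mathcal P$ or $Y\in\mathcal P$; the sets $\mathrm{supp}(X)=\{\mathcal P\mid X\notin\mathcal P\}$ form a basis of its closed sets. Put $\mathcal Z_{\mathcal K,\Phi}=\bigcap_{X\in\Phi}\mathrm{supp}(X)$. $\mathrm{Spec}^h(R^\bullet)$ is the space of homogeneous prime ideals with the Zariski topology, and the comparison map is $$\rho^\bullet_{\mathcal K,\Phi}:\mathcal Z_{\mathcal K,\Phi}\to\mathrm{Spec}^h(R^\bullet_{\mathcal K,\Phi}),\qquad \mathcal P\mapsto\{[f]\ \text{homogeneous}\mid \mathrm{cone}(f)\notin\mathcal P\}.$$ Theorem. Let $\mathcal K$ be a tensor triangulated category, $\Phi$ a non-empty collection of objects closed under $\otimes$, $S\subset R^\bullet_{\mathcal K,\Phi}$ a multiplicative set (containing $1$) of homogeneous elements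 of even degree (hence central), and $q:\mathcal K\to\mathcal K/\mathcal J$ the Verdier quotient, in the sense of tensor triangulated categories, by the thick $\otimes$-ideal $\mathcal J$ generated by the objects $\mathrm{cone}(s)$ for all representatives $s$ of elements $[s]\in S$. Write $R^\bullet_{\mathcal K/\mathcal J,\Phi}$ and $\mathcal Z_{\mathcal K/\mathcal J,\Phi}$ for the objects attached to $\mathcal K/\mathcal J$ and the collection of objects isomorphic to some $q(X)$, $X\in\Phi$. Then: 1. There is a ring isomorphism $S^{-1}R^\bullet_{\mathcal K,\Phi}\cong R^\bullet_{\mathcal K/\mathcal J,\Phi}$ under which the localization map $R^\bullet_{\mathcal K,\Phi}\to S^{-1}R^\bullet_{\mathcal K,\Phi}$ becomes the map $[f]\mapsto[q(f)]$. It is graded: for every $n$, the elements that it sends to degree $n$ are exactly the fractions $x/s$ with $x$ homogeneous of some degree $i$ and $s\in S$ homogeneous of some degree $j$ with $i-j=n$. 2. Consider the square $$\begin{array}{ccc}\mathcal Z_{\mathcal K/\mathcal J,\Phi}&\hookrightarrow&\mathcal Z_{\mathcal K,\Phi}\\ \downarrow&&\downarrow\\ \mathrm{Spec}^h(R^\bullet_{\mathcal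 K/\mathcal J,\Phi})&\hookrightarrow&\mathrm{Spec}^h(R^\bullet_{\mathcal K,\Phi})\end{array}$$ whose vertical maps are $\rho^\bullet_{\mathcal K/\mathcal J,\Phi}$ and $\rho^\bullet_{\mathcal K,\Phi}$, whose top map is $\mathcal Q\mapsto q^{-1}(\mathcal Q)$, and whose bottom map is the inverse image of homogeneous primes along $[f]\mapsto[q(f)]$. All four maps are continuous. The bottom map is a homeomorphism onto the subspace $\{\mathfrak p\mid\mathfrak p\cap S=\emptyset\}$, the top map is a homeomorphism onto the subspace $\{\mathcal P\in\mathcal Z_{\mathcal K,\Phi}\mid\rho^\bullet_{\mathcal K,\Phi}(\mathcal P)\cap S=\emptyset\}$, and the square is commutative and cartesian in topological spaces. -/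

import Mathlib

open CategoryTheory MonoidalCategory Limits Pretriangulated DirectSum ZeroObject

universe v u v' u'

set_option linter.unusedSectionVars false
set_option linter.unusedSimpArgs false

namespace TTLoc

section Susp

variable (C : Type u) [Category.{v} C] [MonoidalCategory C] [SymmetricCategory C] [HasShift C ℤ]

/-- The data of suspension isomorphisms `Σⁿ X ⊗ Y ≅ Σⁿ (X ⊗ Y)`, natural in `X` and compatible
with `Σᵐ⁺ⁿ ≅ Σᵐ Σⁿ`. -/
class TensorSuspension where
  commShift (Y : C) : (tensorRight Y).CommShift ℤ

attribute [reducible] TensorSuspension.commShift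
attribute [instance] TensorSuspension.commShift

end Susp

section

variable {C : Type u} [Category.{v} C] [MonoidalCategory C] [SymmetricCategory C] [HasShift C ℤ]
  [TensorSuspension C]

/-- The suspension isomorphism `Σⁿ X ⊗ Y ≅ Σⁿ (X ⊗ Y)`. -/
noncomputable def suspLeft (X Y : C) (n : ℤ) : X⟦n⟧ ⊗ Y ≅ (X ⊗ Y)⟦n⟧ :=
  ((tensorRight Y).commShiftIso n).app X

/-- The suspension isomorphism `X ⊗ Σⁿ Y ≅ Σⁿ (X ⊗ Y)`, obtained from the other one by symmetry. -/
noncomputable def suspRight (X Y : C) (n : ℤ) : X ⊗ Y⟦n⟧ ≅ (X ⊗ Y)⟦n⟧ :=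
  β_ X (Y⟦n⟧) ≪≫ suspLeft Y X n ≪≫ (shiftFunctor C n).mapIso (β_ Y X)

end

/-- A tensor triangulated category: a triangulated category with a compatible symmetric monoidal
structure. -/
class TensorTriangulated (C : Type u) [Category.{v} C] [Preadditive C] [HasZeroObject C]
    [HasShift C ℤ] [∀ n : ℤ, (shiftFunctor C n).Additive] [Pretriangulated C] [IsTriangulated C]
    [MonoidalCategory C] [SymmetricCategory C] [MonoidalPreadditive C]
    extends TensorSuspension C where
  exact_tensorRight (Y : C) : (tensorRight Y).IsTriangulated
  susp_natural (X : C) {Y Y' : C} (g : Y ⟶ Y') (n : ℤ) :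
    X⟦n⟧ ◁ g ≫ (suspLeft X Y' n).hom = (suspLeft X Y n).hom ≫ (X ◁ g)⟦n⟧'
  susp_unit (X : C) (n : ℤ) :
    (suspLeft X (𝟙_ C) n).hom ≫ (ρ_ X).hom⟦n⟧' = (ρ_ (X⟦n⟧)).hom
  susp_assoc (X Y Z : C) (n : ℤ) :
    (α_ (X⟦n⟧) Y Z).hom ≫ (suspLeft X (Y ⊗ Z) n).hom =
      (suspLeft X Y n).hom ▷ Z ≫ (suspLeft (X ⊗ Y) Z n).hom ≫ (α_ X Y Z).hom⟦n⟧'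
  susp_anticomm (X Y : C) (m n : ℤ) :
    (suspLeft X (Y⟦n⟧) m).hom ≫ (suspRight X Y n).hom⟦m⟧' =
      (m * n).negOnePow • ((suspRight (X⟦m⟧) Y n).hom ≫ (suspLeft X Y m).hom⟦n⟧' ≫
        (shiftComm (X ⊗ Y) m n).hom)

section GradedEnd

variable {C : Type u} [Category.{v} C] [Preadditive C] [HasZeroObject C]
    [HasShift C ℤ] [∀ n : ℤ, (shiftFunctor C n).Additive] [Pretriangulated C] [IsTriangulated C]
    [MonoidalCategory C] [SymmetricCategory C] [MonoidalPreadditive C] [TensorTriangulated C]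

/-- Graded endomorphisms `Σⁱ X ⟶ X` of degree `i`. -/
abbrev GEnd (X : C) (i : ℤ) : Type v := X⟦i⟧ ⟶ X

namespace GEnd

/-- The graded product `f ∘ Σⁱ g`. -/
noncomputable def mul {X : C} {i j k : ℤ} (f : GEnd X i) (g : GEnd X j) (h : i + j = k) :
    GEnd X k :=
  (shiftFunctorAdd' C j i k (by rw [add_comm, h])).hom.app X ≫ g⟦i⟧' ≫ f

/-- The identity, as a graded endomorphism of degree `0`. -/
noncomputable def one (X : C) : GEnd X 0 := (shiftFunctorZero C ℤ).hom.app X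

/-- Transport of a graded endomorphism along an isomorphism. -/
noncomputable def conj {X Y : C} (α : X ≅ Y) {i : ℤ} (f : GEnd X i) : GEnd Y i :=
  α.inv⟦i⟧' ≫ f ≫ α.hom

/-- `f ⊗ Y`, up to the suspension isomorphism. -/
noncomputable def tensorR {X : C} {i : ℤ} (f : GEnd X i) (Y : C) : GEnd (X ⊗ Y) i :=
  (suspLeft X Y i).inv ≫ f ▷ Y

/-- `X ⊗ g`, up to the suspension isomorphism. -/
noncomputable def tensorL (X : C) {Y : C} {i : ℤ} (g : GEnd Y i) : GEnd (X ⊗ Y) i :=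
  (suspRight X Y i).inv ≫ X ◁ g

/-- A graded endomorphism is `⊗`-balanced if `f ⊗ X = X ⊗ f`. -/
def Balanced {X : C} {i : ℤ} (f : GEnd X i) : Prop := f.tensorR X = tensorL X f

section lemmas

variable {X Y Z : C} {i j k l m : ℤ}

lemma mul_assoc' {ij jk ijk : ℤ} (f : GEnd X i) (g : GEnd X j) (h : GEnd X k)
    (h₁ : i + j = ij) (h₂ : j + k = jk) (h₃ : ij + k = ijk) :
    (f.mul g h₁).mul h h₃ = f.mul (g.mul h h₂) (by omega) := by
  have := shiftFunctorAdd'_assoc_hom_app k j i jk ij ijk (by omega) (by omega) (by omega) X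
  have nat := (shiftFunctorAdd' C j i ij (by omega)).hom.naturality h
  simp only [Functor.comp_map] at nat
  simp only [mul, Functor.map_comp, Category.assoc]
  rw [reassoc_of% nat, reassoc_of% this]

lemma one_mul' (f : GEnd X i) : (one X).mul f (zero_add i) = f := by
  have nat := (shiftFunctorZero C ℤ).hom.naturality f
  simp only [Functor.id_map] at nat
  simp only [mul, one, nat]
  rw [shiftFunctorAdd'_add_zero_hom_app]
  simp

lemma mul_one' (f : GEnd X i) : f.mul (one X) (add_zero i) = f := by
  simp only [mul, one]
  rw [shiftFunctorAdd'_zero_add_hom_app, ← Category.assoc, ← Functor.map_comp]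
  simp

lemma mul_add (f : GEnd X i) (g g' : GEnd X j) (h : i + j = k) :
    f.mul (g + g') h = f.mul g h + f.mul g' h := by simp [mul, Functor.map_add]

lemma add_mul (f f' : GEnd X i) (g : GEnd X j) (h : i + j = k) :
    mul (f + f') g h = f.mul g h + f'.mul g h := by simp [mul]

lemma mul_zero (f : GEnd X i) (h : i + j = k) : f.mul (0 : GEnd X j) h = 0 := by simp [mul]

lemma zero_mul (g : GEnd X j) (h : i + j = k) : mul (0 : GEnd X i) g h = 0 := by simp [mul]

lemma conj_mul (α : X ≅ Y) (f : GEnd X i) (g : GEnd X j) (h : i + j = k) :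
    conj α (f.mul g h) = (conj α f).mul (conj α g) h := by
  have nat := (shiftFunctorAdd' C j i k (by omega)).hom.naturality α.inv
  simp only [Functor.comp_map] at nat
  simp only [mul, conj, Functor.map_comp, Category.assoc, reassoc_of% nat]
  simp only [← Functor.map_comp_assoc, Iso.hom_inv_id, Functor.map_id, Category.id_comp]
  simp

lemma conj_one (α : X ≅ Y) : conj α (one X) = one Y := by
  have nat := (shiftFunctorZero C ℤ).hom.naturality α.inv
  simp only [Functor.id_map] at nat
  simp [conj, one, reassoc_of% nat]

lemma conj_add (α : X ≅ Y) (f g : GEnd X i) : conj α (f + g) = conj α f + conj α g := by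
  simp [conj]

lemma conj_trans (α : X ≅ Y) (β : Y ≅ Z) (f : GEnd X i) :
    conj (α ≪≫ β) f = conj β (conj α f) := by simp [conj]

lemma conj_refl (f : GEnd X i) : conj (Iso.refl X) f = f := by simp [conj]

lemma conj_congr {α β : X ≅ Y} (h : α = β) (f : GEnd X i) : conj α f = conj β f := by rw [h]

lemma conj_symm_eq (α : X ≅ Y) (f : GEnd X i) (g : GEnd Y i) (h : conj α f = g) :
    conj α.symm g = f := by
  rw [← h, ← conj_trans, Iso.self_symm_id, conj_refl]

lemma eq_of_conj (α : X ≅ Y) {f g : GEnd X i} (h : conj α f = conj α g) : f = g := by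
  rw [← conj_symm_eq α f _ h, conj_symm_eq α g _ rfl]

lemma tensorR_add (f f' : GEnd X i) (Y : C) :
    tensorR (f + f') Y = f.tensorR Y + f'.tensorR Y := by simp [tensorR]

lemma tensorR_mul (f : GEnd X i) (g : GEnd X j) (h : i + j = k) (Y : C) :
    (f.mul g h).tensorR Y = (f.tensorR Y).mul (g.tensorR Y) h := by
  have e := NatTrans.congr_app (congr_arg Iso.inv
    ((tensorRight Y).commShiftIso_add' (show j + i = k by omega))) X
  have nat := ((tensorRight Y).commShiftIso i).inv.naturality g
  simp only [Functor.CommShift.isoAdd'_inv_app] at e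
  simp only [Functor.comp_map] at nat
  dsimp at e nat
  simp only [tensorR, mul, suspLeft, Iso.app_inv, Functor.map_comp, Category.assoc,
    comp_whiskerRight]
  erw [e]
  simp only [Category.assoc]
  rw [reassoc_of% nat]
  congr 3
  rw [← comp_whiskerRight_assoc, ← comp_whiskerRight, ← comp_whiskerRight, Iso.inv_hom_id_app]
  simp

lemma tensorR_one (X Y : C) : (one X).tensorR Y = one (X ⊗ Y) := by
  have e := NatTrans.congr_app (congr_arg Iso.inv
    ((tensorRight Y).commShiftIso_zero ℤ)) X
  simp only [tensorR, one, suspLeft, Iso.app_inv, e]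
  simp [← comp_whiskerRight]

lemma suspLeft_natural_left {X X' : C} (f : X ⟶ X') (Y : C) (n : ℤ) :
    f⟦n⟧' ▷ Y ≫ (suspLeft X' Y n).hom = (suspLeft X Y n).hom ≫ (f ▷ Y)⟦n⟧' :=
  ((tensorRight Y).commShiftIso n).hom.naturality f

lemma conj_tensorR_left (α : X ≅ Y) (f : GEnd X i) (Z : C) :
    (conj α f).tensorR Z = conj (whiskerRightIso α Z) (f.tensorR Z) := by
  simp only [tensorR, conj, comp_whiskerRight, whiskerRightIso_hom, whiskerRightIso_inv,
    Category.assoc]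
  rw [← cancel_epi (suspLeft Y Z i).hom, Iso.hom_inv_id_assoc, ← reassoc_of% suspLeft_natural_left]
  simp

lemma conj_tensorR_right (f : GEnd X i) (α : Y ≅ Z) :
    conj (whiskerLeftIso X α) (f.tensorR Y) = f.tensorR Z := by
  simp only [tensorR, conj, whiskerLeftIso_hom, whiskerLeftIso_inv, Category.assoc]
  rw [← cancel_epi (suspLeft X Z i).hom, Iso.hom_inv_id_assoc,
    ← reassoc_of% (TensorTriangulated.susp_natural X α.inv i)]
  simp [← whisker_exchange]

lemma tensorL_eq (X : C) (g : GEnd Y i) : tensorL X g = conj (β_ Y X) (g.tensorR X) := by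
  simp [tensorL, tensorR, conj, suspRight, ← SymmetricCategory.braiding_swap_eq_inv_braiding Y X,
    ← SymmetricCategory.braiding_swap_eq_inv_braiding X (Y⟦i⟧)]

lemma conj_braiding_tensorL (g : GEnd Y i) : conj (β_ X Y) (tensorL X g) = g.tensorR X := by
  rw [tensorL_eq, ← conj_trans, conj_congr (show β_ Y X ≪≫ β_ X Y = Iso.refl _ by ext; simp),
    conj_refl]

lemma conj_assoc_tensorR (f : GEnd X i) (Y Z : C) :
    conj (α_ X Y Z) ((f.tensorR Y).tensorR Z) = f.tensorR (Y ⊗ Z) := by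
  simp only [tensorR, conj, comp_whiskerRight, Category.assoc]
  rw [← cancel_epi (suspLeft X (Y ⊗ Z) i).hom, Iso.hom_inv_id_assoc,
    ← cancel_epi (α_ (X⟦i⟧) Y Z).hom]
  rw [reassoc_of% (TensorTriangulated.susp_assoc X Y Z i)]
  simp only [← Functor.map_comp_assoc, Iso.hom_inv_id, Functor.map_id, Category.id_comp,
    Iso.hom_inv_id_assoc]
  rw [CategoryTheory.Functor.map_id, Category.id_comp, Iso.hom_inv_id_assoc,
    ← comp_whiskerRight_assoc, Iso.hom_inv_id, id_whiskerRight, Category.id_comp,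
    associator_naturality_left]

lemma tensorL_add (X : C) (g g' : GEnd Y i) :
    tensorL X (g + g') = tensorL X g + tensorL X g' := by simp [tensorL]

lemma tensorL_mul (X : C) (f : GEnd Y i) (g : GEnd Y j) (h : i + j = k) :
    tensorL X (f.mul g h) = (tensorL X f).mul (tensorL X g) h := by
  simp only [tensorL_eq, tensorR_mul, conj_mul]

lemma tensorL_one (X Y : C) : tensorL X (one Y) = one (X ⊗ Y) := by
  simp only [tensorL_eq, tensorR_one, conj_one]

lemma conj_tensorL_right (α : X ≅ Y) (f : GEnd X i) (Z : C) :
    tensorL Z (conj α f) = conj (whiskerLeftIso Z α) (tensorL Z f) := by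
  simp only [tensorL_eq, conj_tensorR_left, ← conj_trans]
  apply conj_congr; ext; simp

lemma conj_tensorL_left (f : GEnd X i) (α : Y ≅ Z) :
    conj (whiskerRightIso α X) (tensorL Y f) = tensorL Z f := by
  simp only [tensorL_eq, ← conj_trans]
  rw [← conj_tensorR_right f α, ← conj_trans]
  apply conj_congr; ext; simp

lemma conj_assoc_mid (X : C) (f : GEnd Y i) (Z : C) :
    conj (α_ X Y Z) ((tensorL X f).tensorR Z) = tensorL X (f.tensorR Z) := by
  simp only [tensorL_eq, conj_tensorR_left]
  rw [← conj_assoc_tensorR f Z X |> conj_symm_eq _ _ _, ← conj_tensorR_right f (β_ X Z),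
    ← conj_assoc_tensorR f X Z]
  simp only [← conj_trans]
  apply conj_congr
  ext
  simp [BraidedCategory.braiding_tensor_left_hom, ← whiskerLeft_comp_assoc]

lemma conj_assoc_tensorL (X Y : C) (f : GEnd Z i) :
    conj (α_ X Y Z) (tensorL (X ⊗ Y) f) = tensorL X (tensorL Y f) := by
  rw [tensorL_eq Y f, conj_tensorL_right, ← conj_assoc_mid, tensorL_eq (X ⊗ Y) f,
    tensorL_eq X f, conj_tensorR_left, ← conj_assoc_tensorR f X Y]
  simp only [← conj_trans]
  apply conj_congr
  ext
  simp

lemma suspRight_natural_left {X X' : C} (f : X ⟶ X') (Y : C) (n : ℤ) :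
    f ▷ (Y⟦n⟧) ≫ (suspRight X' Y n).hom = (suspRight X Y n).hom ≫ (f ▷ Y)⟦n⟧' := by
  simp only [suspRight, Iso.trans_hom, Functor.mapIso_hom, Category.assoc,
    BraidedCategory.braiding_naturality_left_assoc,
    reassoc_of% (TensorTriangulated.susp_natural Y f n), ← Functor.map_comp,
    BraidedCategory.braiding_naturality_right]

lemma mul_tensorL_tensorR (f : GEnd X i) (g : GEnd Y j) (h : i + j = k) :
    (f.tensorR Y).mul (tensorL X g) h =
      (i * j).negOnePow • (tensorL X g).mul (f.tensorR Y) (by omega) := by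
  have h₁ : (X ◁ g)⟦i⟧' ≫ (suspLeft X Y i).inv = (suspLeft X (Y⟦j⟧) i).inv ≫ X⟦i⟧ ◁ g := by
    rw [← cancel_epi (suspLeft X (Y⟦j⟧) i).hom, ← cancel_mono (suspLeft X Y i).hom]
    simp [TensorTriangulated.susp_natural X g i]
  have h₂ : (f ▷ Y)⟦j⟧' ≫ (suspRight X Y j).inv = (suspRight (X⟦i⟧) Y j).inv ≫ f ▷ (Y⟦j⟧) := by
    rw [← cancel_epi (suspRight (X⟦i⟧) Y j).hom, ← cancel_mono (suspRight X Y j).hom]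
    simp [suspRight_natural_left f Y j]
  have h₃ : (suspRight X Y j).inv⟦i⟧' ≫ (suspLeft X (Y⟦j⟧) i).inv =
      (i * j).negOnePow • ((shiftComm (X ⊗ Y) i j).inv ≫ (suspLeft X Y i).inv⟦j⟧' ≫
        (suspRight (X⟦i⟧) Y j).inv) := by
    rw [← cancel_epi ((suspRight X Y j).hom⟦i⟧'), ← cancel_epi (suspLeft X (Y⟦j⟧) i).hom]
    rw [← Category.assoc _ _ (_ • _), TensorTriangulated.susp_anticomm X Y i j]
    simp only [Linear.units_smul_comp, Linear.comp_units_smul, smul_smul, Int.units_mul_self,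
      one_smul]
    simp [← Functor.map_comp_assoc, ← Functor.map_comp]
  have h₄ : (shiftFunctorAdd' C j i k (by omega)).hom.app (X ⊗ Y) ≫
      (shiftComm (X ⊗ Y) i j).inv = (shiftFunctorAdd' C i j k h).hom.app (X ⊗ Y) := by
    simp [shiftComm, shiftFunctorComm_eq C i j k h]
  simp only [mul, tensorL, tensorR, Functor.map_comp, Category.assoc, reassoc_of% h₁,
    reassoc_of% h₂, reassoc_of% h₃, Linear.units_smul_comp, Linear.comp_units_smul]
  rw [reassoc_of% h₄, whisker_exchange]

lemma conj_neg (α : X ≅ Y) (f : GEnd X i) : conj α (-f) = -conj α f := by simp [conj]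

lemma tensorR_zero (X Y : C) : tensorR (0 : GEnd X i) Y = 0 := by simp [tensorR]

lemma tensorL_zero (X Y : C) : tensorL X (0 : GEnd Y i) = 0 := by simp [tensorL]

lemma tensorR_neg (f : GEnd X i) (Y : C) : tensorR (-f) Y = -f.tensorR Y :=
  eq_neg_of_add_eq_zero_left (by rw [← tensorR_add, neg_add_cancel, tensorR_zero])

lemma tensorL_neg (X : C) (f : GEnd Y i) : tensorL X (-f) = -tensorL X f :=
  eq_neg_of_add_eq_zero_left (by rw [← tensorL_add, neg_add_cancel, tensorL_zero])

namespace Balanced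

lemma zero (X : C) (i : ℤ) : Balanced (0 : GEnd X i) := by
  simp [Balanced, tensorR_zero, tensorL_zero]

lemma one (X : C) : Balanced (one X) := by
  simp [Balanced, tensorR_one, tensorL_one]

lemma neg {f : GEnd X i} (hf : Balanced f) : Balanced (-f) := by
  unfold Balanced at *; rw [tensorR_neg, tensorL_neg, hf]

lemma add {f g : GEnd X i} (hf : Balanced f) (hg : Balanced g) : Balanced (f + g) := by
  unfold Balanced at *; rw [tensorR_add, tensorL_add, hf, hg]

lemma mul {f : GEnd X i} {g : GEnd X j} (hf : Balanced f) (hg : Balanced g) (h : i + j = k) :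
    Balanced (f.mul g h) := by
  unfold Balanced at *; rw [tensorR_mul, tensorL_mul, hf, hg]

lemma conj {f : GEnd X i} (hf : Balanced f) (α : X ≅ Y) : Balanced (conj α f) := by
  unfold Balanced at *
  rw [conj_tensorR_left, conj_tensorL_right, ← conj_tensorR_right f α, hf,
    ← conj_tensorL_left f α, ← conj_trans, ← conj_trans]
  apply conj_congr
  ext
  simp [whisker_exchange]

lemma tensorR {f : GEnd X i} (hf : Balanced f) (Y : C) : Balanced (f.tensorR Y) := by
  unfold Balanced at *
  have h₁ : (f.tensorR Y).tensorR (X ⊗ Y) =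
      GEnd.conj (α_ X Y (X ⊗ Y)).symm (f.tensorR (Y ⊗ (X ⊗ Y))) :=
    (conj_symm_eq _ _ _ (conj_assoc_tensorR f Y (X ⊗ Y))).symm
  have h₂ : GEnd.tensorL (X ⊗ Y) (f.tensorR Y) = GEnd.conj (α_ X Y (X ⊗ Y)).symm
      (GEnd.tensorL X (GEnd.tensorL Y (f.tensorR Y))) :=
    (conj_symm_eq _ _ _ (conj_assoc_tensorL X Y (f.tensorR Y))).symm
  have h₃ : GEnd.tensorL Y (f.tensorR Y) = GEnd.conj
      ((α_ X Y Y).symm ≪≫ whiskerRightIso (β_ X Y) Y ≪≫ α_ Y X Y) (f.tensorR (Y ⊗ Y)) := by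
    rw [← conj_assoc_mid, tensorL_eq Y f, conj_tensorR_left, ← conj_assoc_tensorR f Y Y]
    simp only [← conj_trans]
    apply conj_congr
    ext
    simp
  rw [h₁, h₂, h₃]
  congr 1
  rw [conj_tensorL_right]
  have h₄ : GEnd.tensorL X (f.tensorR (Y ⊗ Y)) = f.tensorR (X ⊗ (Y ⊗ Y)) := by
    rw [← conj_assoc_mid, ← hf, conj_assoc_tensorR]
  rw [h₄, conj_tensorR_right]

lemma tensorL {f : GEnd X i} (hf : Balanced f) (Y : C) : Balanced (tensorL Y f) := by
  rw [tensorL_eq]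
  exact (hf.tensorR Y).conj _

end Balanced

end lemmas
end GEnd

/-- A non-empty collection of objects closed under the tensor product. -/
structure TensorSet (C : Type u) [Category.{v} C] [MonoidalCategory C] where
  carrier : ObjectProperty C
  nonempty : ∃ X, carrier X
  tensor {X Y : C} : carrier X → carrier Y → carrier (X ⊗ Y)

/-- A pair `(X, f)` with `X ∈ Φ` and `f` a `⊗`-balanced graded endomorphism of `X` of
degree `i`. -/
structure Rep (Φ : TensorSet C) (i : ℤ) where
  obj : C
  mem : Φ.carrier obj
  hom : GEnd obj i
  balanced : hom.Balanced

namespace Rep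

variable {Φ : TensorSet C} {i j k : ℤ}

/-- `(a ⊗ X, a ⊗ f)` -/
noncomputable def tensorL (x : Rep Φ i) (a : C) (ha : Φ.carrier a) : Rep Φ i :=
  ⟨a ⊗ x.obj, Φ.tensor ha x.mem, GEnd.tensorL a x.hom, x.balanced.tensorL a⟩

/-- `(X ⊗ a, f ⊗ a)` -/
noncomputable def tensorR (x : Rep Φ i) (a : C) (ha : Φ.carrier a) : Rep Φ i :=
  ⟨x.obj ⊗ a, Φ.tensor x.mem ha, x.hom.tensorR a, x.balanced.tensorR a⟩

/-- The relation generated by `(X, f) ∼ (a ⊗ X, a ⊗ f)` and `(X, f) ∼ (X ⊗ a, f ⊗ a)`. -/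
inductive Rel : Rep Φ i → Rep Φ i → Prop
  | left (x : Rep Φ i) (a : C) (ha : Φ.carrier a) : Rel x (x.tensorL a ha)
  | right (x : Rep Φ i) (a : C) (ha : Φ.carrier a) : Rel x (x.tensorR a ha)

end Rep

/-- The degree `i` part of the graded ring of `Φ`: the classes `[f]` of `⊗`-balanced
endomorphisms of degree `i` of the objects of `Φ`. -/
def R (Φ : TensorSet C) (i : ℤ) : Type (max u v) := Quot (Rep.Rel (Φ := Φ) (i := i))

namespace R

variable {Φ : TensorSet C} {i j k : ℤ}

/-- The class `[f]` of `(X, f)`. -/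
def mk (X : C) (hX : Φ.carrier X) (f : GEnd X i) (hf : f.Balanced) : R Φ i :=
  Quot.mk _ ⟨X, hX, f, hf⟩

lemma ind {p : R Φ i → Prop} (h : ∀ X hX f hf, p (mk X hX f hf)) (x : R Φ i) : p x := by
  induction x using Quot.ind with
  | mk x => exact h x.obj x.mem x.hom x.balanced

lemma mk_tensorL (a X : C) (ha : Φ.carrier a) (hX : Φ.carrier X) (f : GEnd X i)
    (hf : f.Balanced) :
    mk (a ⊗ X) (Φ.tensor ha hX) (GEnd.tensorL a f) (hf.tensorL a) = mk X hX f hf :=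
  (Quot.sound (Rep.Rel.left ⟨X, hX, f, hf⟩ a ha)).symm

lemma mk_tensorR (a X : C) (ha : Φ.carrier a) (hX : Φ.carrier X) (f : GEnd X i)
    (hf : f.Balanced) :
    mk (X ⊗ a) (Φ.tensor hX ha) (f.tensorR a) (hf.tensorR a) = mk X hX f hf :=
  (Quot.sound (Rep.Rel.right ⟨X, hX, f, hf⟩ a ha)).symm

lemma mk_congr {X : C} (hX : Φ.carrier X) {f g : GEnd X i} (hf : f.Balanced) (h : f = g) :
    mk X hX f hf = mk X hX g (h ▸ hf) := by subst h; rfl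

/-- Endomorphisms that correspond under an isomorphism have the same class. -/
lemma mk_conj {X Y : C} (hX : Φ.carrier X) (hY : Φ.carrier Y) (f : GEnd X i)
    (hf : f.Balanced) (α : X ≅ Y) :
    mk Y hY (GEnd.conj α f) (hf.conj α) = mk X hX f hf := by
  rw [← mk_tensorR Y X hY hX f hf, ← mk_tensorL X Y hX hY]
  apply mk_congr
  rw [← GEnd.conj_tensorR_right f α, hf, GEnd.conj_tensorL_right]

lemma mk_eq {X Y : C} (hX : Φ.carrier X) (hY : Φ.carrier Y) {f : GEnd X i} {g : GEnd Y i}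
    (hf : f.Balanced) (hg : g.Balanced) (α : X ≅ Y) (h : GEnd.conj α f = g) :
    mk X hX f hf = mk Y hY g hg := by
  subst h
  exact (mk_conj hX hY f hf α).symm

/-- A binary operation on graded endomorphisms that is compatible with the tensor product and with
isomorphisms. -/
structure BinOp (C : Type u) [Category.{v} C] [Preadditive C] [HasZeroObject C]
    [HasShift C ℤ] [∀ n : ℤ, (shiftFunctor C n).Additive] [Pretriangulated C] [IsTriangulated C]
    [MonoidalCategory C] [SymmetricCategory C] [MonoidalPreadditive C] [TensorTriangulated C]
    (i j k : ℤ) where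
  op {X : C} : GEnd X i → GEnd X j → GEnd X k
  balanced {X : C} {f : GEnd X i} {g : GEnd X j} : f.Balanced → g.Balanced → (op f g).Balanced
  conj {X Y : C} (α : X ≅ Y) (f : GEnd X i) (g : GEnd X j) :
    GEnd.conj α (op f g) = op (GEnd.conj α f) (GEnd.conj α g)
  tensorL (a : C) {X : C} (f : GEnd X i) (g : GEnd X j) :
    GEnd.tensorL a (op f g) = op (GEnd.tensorL a f) (GEnd.tensorL a g)
  tensorR {X : C} (f : GEnd X i) (g : GEnd X j) (a : C) :
    (op f g).tensorR a = op (f.tensorR a) (g.tensorR a)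

/-- Addition, as a binary operation. -/
def BinOp.add (i : ℤ) : BinOp C i i i where
  op f g := f + g
  balanced hf hg := hf.add hg
  conj := GEnd.conj_add
  tensorL a _ f g := GEnd.tensorL_add a f g
  tensorR := GEnd.tensorR_add

/-- The graded product, as a binary operation. -/
noncomputable def BinOp.mul (h : i + j = k) : BinOp C i j k where
  op f g := f.mul g h
  balanced hf hg := hf.mul hg h
  conj α f g := GEnd.conj_mul α f g h
  tensorL a _ f g := GEnd.tensorL_mul a f g h
  tensorR f g a := GEnd.tensorR_mul f g h a

/-- `[f] * [g] = [(f ⊗ Y) * (X ⊗ g)]`, at the level of representatives. -/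
noncomputable def opRep (o : BinOp C i j k) (x : Rep Φ i) (y : Rep Φ j) : R Φ k :=
  mk (x.obj ⊗ y.obj) (Φ.tensor x.mem y.mem)
    (o.op (x.hom.tensorR y.obj) (GEnd.tensorL x.obj y.hom))
    (o.balanced (x.balanced.tensorR _) (y.balanced.tensorL _))

lemma opRep_right (o : BinOp C i j k) (x : Rep Φ i) (y y' : Rep Φ j) (h : Rep.Rel y y') :
    opRep o x y = opRep o x y' := by
  have key : ∀ (y : Rep Φ j) (a : C) (ha : Φ.carrier a),
      opRep o x y = opRep o x (y.tensorR a ha) := fun y a ha => by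
    unfold opRep
    rw [← mk_tensorR a _ ha]
    refine mk_eq _ _ _ _ (α_ x.obj y.obj a) ?_
    dsimp only [Rep.tensorR]
    rw [o.tensorR, o.conj, GEnd.conj_assoc_tensorR, GEnd.conj_assoc_mid]
  cases h with
  | right a ha => exact key y a ha
  | left a ha =>
    rw [key y a ha]
    refine mk_eq _ _ _ _ (whiskerLeftIso x.obj (β_ y.obj a)) ?_
    dsimp only [Rep.tensorR, Rep.tensorL]
    rw [o.conj, GEnd.conj_tensorR_right, ← GEnd.conj_tensorL_right, ← GEnd.tensorL_eq]

lemma opRep_left (o : BinOp C i j k) (x x' : Rep Φ i) (y : Rep Φ j) (h : Rep.Rel x x') :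
    opRep o x y = opRep o x' y := by
  have key : ∀ (x : Rep Φ i) (a : C) (ha : Φ.carrier a),
      opRep o x y = opRep o (x.tensorL a ha) y := fun x a ha => by
    unfold opRep
    rw [← mk_tensorL a _ ha]
    refine (mk_eq _ _ _ _ (α_ a x.obj y.obj) ?_).symm
    dsimp only [Rep.tensorL]
    rw [o.tensorL, o.conj, GEnd.conj_assoc_tensorL, GEnd.conj_assoc_mid]
  cases h with
  | left a ha => exact key x a ha
  | right a ha =>
    rw [key x a ha]
    refine mk_eq _ _ _ _ (whiskerRightIso (β_ a x.obj) y.obj) ?_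
    dsimp only [Rep.tensorR, Rep.tensorL]
    rw [o.conj, GEnd.conj_tensorL_left, ← GEnd.conj_tensorR_left, GEnd.conj_braiding_tensorL]

/-- The operation on classes induced by a binary operation. -/
noncomputable def op (o : BinOp C i j k) : R Φ i → R Φ j → R Φ k :=
  Quot.lift₂ (opRep o) (opRep_right o) (opRep_left o)

lemma op_mk (o : BinOp C i j k) {X : C} (hX : Φ.carrier X) {f : GEnd X i} {g : GEnd X j}
    (hf : f.Balanced) (hg : g.Balanced) :
    op o (mk X hX f hf) (mk X hX g hg) = mk X hX (o.op f g) (o.balanced hf hg) := by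
  rw [← mk_tensorR X X hX hX (o.op f g)]
  refine mk_congr _ _ ?_
  rw [o.tensorR]
  dsimp only
  rw [hg]

lemma exists₂ (x : R Φ i) (y : R Φ j) : ∃ (X : C) (hX : Φ.carrier X) (f : GEnd X i)
    (g : GEnd X j) (hf : f.Balanced) (hg : g.Balanced), x = mk X hX f hf ∧ y = mk X hX g hg := by
  induction x using ind with | h X hX f hf => _
  induction y using ind with | h Y hY g hg => _
  exact ⟨X ⊗ Y, Φ.tensor hX hY, f.tensorR Y, GEnd.tensorL X g, hf.tensorR Y, hg.tensorL X,
    (mk_tensorR Y X hY hX f hf).symm, (mk_tensorL X Y hX hY g hg).symm⟩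

lemma exists₃ (x : R Φ i) (y : R Φ j) (z : R Φ k) : ∃ (X : C) (hX : Φ.carrier X) (f : GEnd X i)
    (g : GEnd X j) (h : GEnd X k) (hf : f.Balanced) (hg : g.Balanced) (hh : h.Balanced),
    x = mk X hX f hf ∧ y = mk X hX g hg ∧ z = mk X hX h hh := by
  obtain ⟨X, hX, f, g, hf, hg, rfl, rfl⟩ := exists₂ x y
  induction z using ind with | h Y hY h hh => _
  exact ⟨X ⊗ Y, Φ.tensor hX hY, f.tensorR Y, g.tensorR Y, GEnd.tensorL X h, hf.tensorR Y,
    hg.tensorR Y, hh.tensorL X, (mk_tensorR Y X hY hX f hf).symm,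
    (mk_tensorR Y X hY hX g hg).symm, (mk_tensorL X Y hX hY h hh).symm⟩

noncomputable instance : Add (R Φ i) := ⟨op (BinOp.add i)⟩

noncomputable instance : Zero (R Φ i) :=
  ⟨mk Φ.nonempty.choose Φ.nonempty.choose_spec 0 (GEnd.Balanced.zero _ _)⟩

noncomputable instance : Neg (R Φ i) :=
  ⟨Quot.lift (fun x => mk x.obj x.mem (-x.hom) x.balanced.neg) (by
    rintro x y h
    cases h with
    | left a ha =>
      rw [← mk_tensorL a _ ha]
      exact mk_congr _ _ (GEnd.tensorL_neg _ _)
    | right a ha =>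
      rw [← mk_tensorR a _ ha]
      exact mk_congr _ _ (GEnd.tensorR_neg _ _))⟩

/-- The graded product. -/
noncomputable def mul (h : i + j = k) : R Φ i → R Φ j → R Φ k := op (BinOp.mul h)

lemma mk_add {X : C} (hX : Φ.carrier X) {f g : GEnd X i} (hf : f.Balanced) (hg : g.Balanced) :
    mk X hX f hf + mk X hX g hg = mk X hX (f + g) (hf.add hg) := op_mk _ hX hf hg

lemma mk_mul (h : i + j = k) {X : C} (hX : Φ.carrier X) {f : GEnd X i} {g : GEnd X j}
    (hf : f.Balanced) (hg : g.Balanced) :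
    mul h (mk X hX f hf) (mk X hX g hg) = mk X hX (f.mul g h) (hf.mul hg h) := op_mk _ hX hf hg

lemma mk_neg {X : C} (hX : Φ.carrier X) {f : GEnd X i} (hf : f.Balanced) :
    -mk X hX f hf = mk X hX (-f) hf.neg := rfl

lemma mk_zero {X : C} (hX : Φ.carrier X) :
    mk X hX 0 (GEnd.Balanced.zero X i) = (0 : R Φ i) := by
  have h₁ := mk_tensorR Φ.nonempty.choose X Φ.nonempty.choose_spec hX
    (0 : GEnd X i) (GEnd.Balanced.zero _ _)
  have h₂ := mk_tensorL X Φ.nonempty.choose hX Φ.nonempty.choose_spec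
    (0 : GEnd _ i) (GEnd.Balanced.zero _ _)
  refine h₁.symm.trans (Eq.trans (mk_congr _ _ ?_) h₂)
  rw [GEnd.tensorR_zero, GEnd.tensorL_zero]

/-- The class of the identity. -/
noncomputable def one : R Φ 0 :=
  mk Φ.nonempty.choose Φ.nonempty.choose_spec (GEnd.one _) (GEnd.Balanced.one _)

lemma mk_one {X : C} (hX : Φ.carrier X) :
    mk X hX (GEnd.one X) (GEnd.Balanced.one X) = (one : R Φ 0) := by
  have h₁ := mk_tensorR Φ.nonempty.choose X Φ.nonempty.choose_spec hX
    (GEnd.one X) (GEnd.Balanced.one _)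
  have h₂ := mk_tensorL X Φ.nonempty.choose hX Φ.nonempty.choose_spec
    (GEnd.one _) (GEnd.Balanced.one _)
  refine h₁.symm.trans (Eq.trans (mk_congr _ _ ?_) h₂)
  rw [GEnd.tensorR_one, GEnd.tensorL_one]

noncomputable instance : AddCommGroup (R Φ i) where
  add_assoc x y z := by
    obtain ⟨X, hX, f, g, h, hf, hg, hh, rfl, rfl, rfl⟩ := exists₃ x y z
    simp only [mk_add, add_assoc]
  zero_add x := by
    induction x using ind with | h X hX f hf => _
    rw [← mk_zero hX, mk_add]
    exact mk_congr _ _ (zero_add f)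
  add_zero x := by
    induction x using ind with | h X hX f hf => _
    rw [← mk_zero hX, mk_add]
    exact mk_congr _ _ (add_zero f)
  nsmul := nsmulRec
  zsmul := zsmulRec
  neg_add_cancel x := by
    induction x using ind with | h X hX f hf => _
    rw [← mk_zero hX, mk_neg, mk_add]
    exact mk_congr _ _ (neg_add_cancel f)
  add_comm x y := by
    obtain ⟨X, hX, f, g, hf, hg, rfl, rfl⟩ := exists₂ x y
    simp only [mk_add, add_comm]

lemma sigma_mul (h : i + j = k) (x : R Φ i) (y : R Φ j) :
    (GradedMonoid.mk (i + j) (mul rfl x y) : GradedMonoid (R Φ)) =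
      GradedMonoid.mk k (mul h x y) := by subst h; rfl

noncomputable instance : GradedMonoid.GMul (R Φ) := ⟨fun x y => mul rfl x y⟩

noncomputable instance : GradedMonoid.GOne (R Φ) := ⟨one⟩

lemma gMul_eq (x : R Φ i) (y : R Φ j) : GradedMonoid.GMul.mul x y = mul rfl x y := rfl

noncomputable instance : GradedMonoid.GMonoid (R Φ) where
  one_mul x := by
    obtain ⟨i, x⟩ := x
    refine (sigma_mul (zero_add i) one x).trans ?_
    induction x using ind with | h X hX f hf => _
    rw [← mk_one hX, mk_mul]
    exact congrArg _ (mk_congr _ _ (GEnd.one_mul' f))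
  mul_one x := by
    obtain ⟨i, x⟩ := x
    refine (sigma_mul (add_zero i) x one).trans ?_
    induction x using ind with | h X hX f hf => _
    rw [← mk_one hX, mk_mul]
    exact congrArg _ (mk_congr _ _ (GEnd.mul_one' f))
  mul_assoc x y z := by
    obtain ⟨i, x⟩ := x
    obtain ⟨j, y⟩ := y
    obtain ⟨k, z⟩ := z
    refine (sigma_mul (add_assoc i j k) (mul rfl x y) z).trans ?_
    obtain ⟨X, hX, f, g, h, hf, hg, hh, rfl, rfl, rfl⟩ := exists₃ x y z
    refine congrArg (GradedMonoid.mk (i + (j + k))) ?_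
    change mul _ (mul rfl (mk X hX f hf) (mk X hX g hg)) (mk X hX h hh) =
      mul rfl (mk X hX f hf) (mul rfl (mk X hX g hg) (mk X hX h hh))
    simp only [mk_mul]
    exact mk_congr _ _ (GEnd.mul_assoc' f g h rfl rfl (add_assoc i j k))

noncomputable instance : DirectSum.GRing (R Φ) where
  mul_zero {i j} x := by
    induction x using ind with | h X hX f hf => _
    rw [← mk_zero hX, gMul_eq, mk_mul, ← mk_zero hX]
    exact mk_congr _ _ (GEnd.mul_zero _ _)
  zero_mul {i j} x := by
    induction x using ind with | h X hX f hf => _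
    rw [← mk_zero hX, gMul_eq, mk_mul, ← mk_zero hX]
    exact mk_congr _ _ (GEnd.zero_mul _ _)
  mul_add x y z := by
    obtain ⟨X, hX, f, g, h, hf, hg, hh, rfl, rfl, rfl⟩ := exists₃ x y z
    simp only [mk_add, gMul_eq, mk_mul]
    exact mk_congr _ _ (GEnd.mul_add _ _ _ _)
  add_mul x y z := by
    obtain ⟨X, hX, f, g, h, hf, hg, hh, rfl, rfl, rfl⟩ := exists₃ x y z
    simp only [mk_add, gMul_eq, mk_mul]
    exact mk_congr _ _ (GEnd.add_mul _ _ _ _)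
  one_mul := GradedMonoid.GMonoid.one_mul
  mul_one := GradedMonoid.GMonoid.mul_one
  mul_assoc := GradedMonoid.GMonoid.mul_assoc
  natCast n := n • one
  natCast_zero := zero_smul ℕ _
  natCast_succ n := succ_nsmul _ n
  intCast n := n • one
  intCast_ofNat n := natCast_zsmul _ n
  intCast_negSucc_ofNat n := negSucc_zsmul _ n

/-- Graded commutativity. -/
lemma mul_comm' (h : i + j = k) (x : R Φ i) (y : R Φ j) :
    mul h x y = (i * j).negOnePow • mul (by omega) y x := by
  obtain ⟨X, hX, f, g, hf, hg, rfl, rfl⟩ := exists₂ x y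
  have key := GEnd.mul_tensorL_tensorR f g h
  rw [← hg, ← GEnd.tensorR_mul] at key
  rw [mk_mul, mk_mul]
  rcases Int.even_or_odd (i * j) with he | ho
  · rw [Int.negOnePow_even _ he, one_smul] at key ⊢
    rw [← GEnd.tensorR_mul] at key
    rw [← mk_tensorR X X hX hX, ← mk_tensorR X X hX hX]
    exact mk_congr _ _ key
  · rw [Int.negOnePow_odd _ ho, Units.neg_smul, one_smul] at key ⊢
    rw [← GEnd.tensorR_mul, ← GEnd.tensorR_neg] at key
    rw [mk_neg, ← mk_tensorR X X hX hX, ← mk_tensorR X X hX hX]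
    exact mk_congr _ _ key

lemma commute_of_even {i j : ℤ} (hi : Even i) (x : R Φ i) (y : R Φ j) :
    Commute (DirectSum.of (R Φ) i x) (DirectSum.of (R Φ) j y) := by
  unfold Commute SemiconjBy
  rw [DirectSum.of_mul_of, DirectSum.of_mul_of]
  apply DirectSum.of_eq_of_gradedMonoid_eq
  rw [gMul_eq, gMul_eq, sigma_mul (add_comm j i), mul_comm' rfl x y,
    Int.negOnePow_even _ (hi.mul_right j), one_smul]

/-- Homogeneous elements of even degree are central. -/
lemma central_of_even {i : ℤ} (hi : Even i) (x : R Φ i) (y : ⨁ j, R Φ j) :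
    Commute (DirectSum.of (R Φ) i x) y := by
  induction y using DirectSum.induction_on with
  | zero => exact Commute.zero_right _
  | of j y => exact commute_of_even hi x y
  | add y z hy hz => exact hy.add_right hz

end R

section Functoriality

variable {D : Type u'} [Category.{v'} D] [Preadditive D] [HasZeroObject D]
    [HasShift D ℤ] [∀ n : ℤ, (shiftFunctor D n).Additive] [Pretriangulated D] [IsTriangulated D]
    [MonoidalCategory D] [SymmetricCategory D] [MonoidalPreadditive D] [TensorTriangulated D]

open Functor.LaxMonoidal Functor.OplaxMonoidal Functor.Monoidal

/-- A morphism of tensor triangulated categories: an exact, strong symmetric monoidal functor, the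
two structures being compatible through the suspension isomorphisms. -/
class IsTensorTriangulated (F : C ⥤ D) [F.CommShift ℤ] [F.Braided] : Prop
    extends F.IsTriangulated where
  susp_comm (X Y : C) (n : ℤ) :
    μ F (X⟦n⟧) Y ≫ F.map (suspLeft X Y n).hom ≫ (F.commShiftIso n).hom.app (X ⊗ Y) =
      (F.commShiftIso n).hom.app X ▷ F.obj Y ≫ (suspLeft (F.obj X) (F.obj Y) n).hom ≫
        (μ F X Y)⟦n⟧'

variable (F : C ⥤ D) [F.CommShift ℤ] [F.Braided] [IsTensorTriangulated F]

namespace GEnd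

variable {X Y : C} {i j k : ℤ}

/-- The image of a graded endomorphism under a functor commuting with the shift. -/
noncomputable def map (f : GEnd X i) : GEnd (F.obj X) i :=
  (F.commShiftIso i).inv.app X ≫ F.map f

lemma map_add (f g : GEnd X i) : map F (f + g) = map F f + map F g := by
  simp [map, F.map_add]

lemma map_one (X : C) : map F (one X) = one (F.obj X) := by
  simp [map, one, F.commShiftIso_zero ℤ, ← F.map_comp]

lemma map_mul (f : GEnd X i) (g : GEnd X j) (h : i + j = k) :
    map F (f.mul g h) = (map F f).mul (map F g) h := by
  have e := NatTrans.congr_app (congr_arg Iso.inv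
    (F.commShiftIso_add' (show j + i = k by omega))) X
  simp only [Functor.CommShift.isoAdd'_inv_app] at e
  have nat := (F.commShiftIso i).inv.naturality g
  simp only [Functor.comp_map] at nat
  have c : F.map ((shiftFunctorAdd' C j i k (by omega)).inv.app X) ≫
      F.map ((shiftFunctorAdd' C j i k (by omega)).hom.app X) = 𝟙 _ := by
    rw [← F.map_comp, Iso.inv_hom_id_app, F.map_id]
  simp only [map, mul, e, F.map_comp, Functor.map_comp, Category.assoc, reassoc_of% c]
  rw [reassoc_of% nat]

lemma map_conj (α : X ≅ Y) (f : GEnd X i) :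
    map F (conj α f) = conj (F.mapIso α) (map F f) := by
  simp [map, conj]

lemma map_tensorR (f : GEnd X i) (Y : C) :
    map F (f.tensorR Y) = conj (μIso F X Y) ((map F f).tensorR (F.obj Y)) := by
  have h := IsTensorTriangulated.susp_comm (F := F) X Y i
  simp only [map, tensorR, conj, μIso_hom, μIso_inv, F.map_comp, comp_whiskerRight, Category.assoc]
  rw [← cancel_epi ((F.commShiftIso i).hom.app (X ⊗ Y)), ← cancel_epi (F.map (suspLeft X Y i).hom),
    ← cancel_epi (μ F (X⟦i⟧) Y)]
  trans μ F (X⟦i⟧) Y ≫ F.map (f ▷ Y)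
  · rw [Iso.hom_inv_id_app_assoc, ← F.map_comp_assoc, Iso.hom_inv_id]
    simp
  · have c₁ : (μ F X Y)⟦i⟧' ≫ (δ F X Y)⟦i⟧' = 𝟙 _ := by
      rw [← Functor.map_comp, μ_δ, CategoryTheory.Functor.map_id]
    have c₂ : (F.commShiftIso i).hom.app X ▷ F.obj Y ≫ (F.commShiftIso i).inv.app X ▷ F.obj Y =
        𝟙 _ := by
      rw [← comp_whiskerRight, Iso.hom_inv_id_app, id_whiskerRight]
    rw [reassoc_of% h, reassoc_of% c₁, Iso.hom_inv_id_assoc, reassoc_of% c₂, μ_natural_left]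

lemma map_tensorL (X : C) (f : GEnd Y i) :
    map F (tensorL X f) = conj (μIso F X Y) (tensorL (F.obj X) (map F f)) := by
  rw [tensorL_eq, map_conj, map_tensorR, tensorL_eq, ← conj_trans, ← conj_trans]
  apply conj_congr
  ext
  simp

lemma Balanced.map {f : GEnd X i} (hf : Balanced f) : Balanced (map F f) := by
  unfold Balanced at *
  apply eq_of_conj (μIso F X X)
  rw [← map_tensorR, ← map_tensorL, hf]

end GEnd

/-- The image of `Φ` under a monoidal functor, closed under isomorphisms. -/
def TensorSet.map (Φ : TensorSet C) (F : C ⥤ D) [F.Monoidal] : TensorSet D where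
  carrier := Φ.carrier.map F
  nonempty := ⟨_, _, Φ.nonempty.choose_spec, ⟨Iso.refl _⟩⟩
  tensor := by
    rintro Y Y' ⟨X, hX, ⟨e⟩⟩ ⟨X', hX', ⟨e'⟩⟩
    exact ⟨X ⊗ X', Φ.tensor hX hX', ⟨(μIso F X X').symm ≪≫ (e ⊗ᵢ e')⟩⟩

lemma TensorSet.map_mem {Φ : TensorSet C} {X : C} (hX : Φ.carrier X) :
    (Φ.map F).carrier (F.obj X) := ⟨X, hX, ⟨Iso.refl _⟩⟩

namespace R

variable (Φ : TensorSet C) {i j k : ℤ}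

/-- `[f] ↦ [F f]` in degree `i`. -/
noncomputable def mapFun (i : ℤ) : R Φ i → R (Φ.map F) i :=
  Quot.lift (fun x => mk (F.obj x.obj) (Φ.map_mem F x.mem) (GEnd.map F x.hom) (x.balanced.map F))
    (by
      intro x y h
      cases h with
      | left a ha =>
        rw [← mk_tensorL (F.obj a) _ (Φ.map_mem F ha)]
        exact mk_eq _ _ _ _ (Functor.Monoidal.μIso F a x.obj) (GEnd.map_tensorL F a x.hom).symm
      | right a ha =>
        rw [← mk_tensorR (F.obj a) _ (Φ.map_mem F ha)]
        exact mk_eq _ _ _ _ (Functor.Monoidal.μIso F x.obj a) (GEnd.map_tensorR F x.hom a).symm)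

lemma mapFun_mk {X : C} (hX : Φ.carrier X) {f : GEnd X i} (hf : f.Balanced) :
    mapFun F Φ i (mk X hX f hf) = mk (F.obj X) (Φ.map_mem F hX) (GEnd.map F f) (hf.map F) := rfl

/-- `[f] ↦ [F f]` in degree `i`, as an additive map. -/
noncomputable def mapAdd (i : ℤ) : R Φ i →+ R (Φ.map F) i :=
  AddMonoidHom.mk' (mapFun F Φ i) (fun x y => by
    obtain ⟨X, hX, f, g, hf, hg, rfl, rfl⟩ := exists₂ x y
    simp only [mapFun_mk, mk_add, GEnd.map_add])

lemma mapAdd_mk {X : C} (hX : Φ.carrier X) {f : GEnd X i} (hf : f.Balanced) :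
    mapAdd F Φ i (mk X hX f hf) = mk (F.obj X) (Φ.map_mem F hX) (GEnd.map F f) (hf.map F) := rfl

lemma mapAdd_mul (h : i + j = k) (x : R Φ i) (y : R Φ j) :
    mapAdd F Φ k (mul h x y) = mul h (mapAdd F Φ i x) (mapAdd F Φ j y) := by
  obtain ⟨X, hX, f, g, hf, hg, rfl, rfl⟩ := exists₂ x y
  simp only [mapAdd_mk, mk_mul, GEnd.map_mul]

lemma mapAdd_one : mapAdd F Φ 0 one = one := by
  rw [← mk_one (Φ := Φ) Φ.nonempty.choose_spec, mapAdd_mk,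
    ← mk_one (Φ.map_mem F Φ.nonempty.choose_spec)]
  exact mk_congr _ _ (GEnd.map_one F _)

/-- The homomorphism of graded rings `[f] ↦ [F f]`. -/
noncomputable def mapRingHom : (⨁ i, R Φ i) →+* ⨁ i, R (Φ.map F) i :=
  DirectSum.toSemiring (fun i => (DirectSum.of (R (Φ.map F)) i).comp (mapAdd F Φ i))
    (congrArg (DirectSum.of (R (Φ.map F)) 0) (mapAdd_one F Φ))
    (fun {i j} x y => by
      simp only [AddMonoidHom.comp_apply, DirectSum.of_mul_of]
      exact congrArg _ (mapAdd_mul F Φ rfl x y))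

lemma mapRingHom_of (x : R Φ i) :
    mapRingHom F Φ (DirectSum.of (R Φ) i x) = DirectSum.of _ i (mapAdd F Φ i x) := by
  simp [mapRingHom]

end R

end Functoriality

end GradedEnd

section Ideals

variable {C : Type u} [Category.{v} C] [Preadditive C] [HasZeroObject C]
    [HasShift C ℤ] [∀ n : ℤ, (shiftFunctor C n).Additive] [Pretriangulated C] [IsTriangulated C]
    [MonoidalCategory C] [SymmetricCategory C] [MonoidalPreadditive C] [TensorTriangulated C]

/-- A thick `⊗`-ideal: a triangulated subcategory, closed under direct summands, and under the
tensor product with arbitrary objects. -/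
structure IsThickTensorIdeal (P : ObjectProperty C) : Prop where
  triangulated : P.IsTriangulated
  retracts : P.IsStableUnderRetracts
  tensor (X : C) {Y : C} : P Y → P (X ⊗ Y)

/-- The thick `⊗`-ideal generated by a collection of objects. -/
def thickTensorIdeal (E : ObjectProperty C) : ObjectProperty C :=
  fun X => ∀ P : ObjectProperty C, IsThickTensorIdeal P → E ≤ P → P X

lemma le_thickTensorIdeal (E : ObjectProperty C) : E ≤ thickTensorIdeal E :=
  fun X hX _ _ h => h X hX

lemma thickTensorIdeal_le {E P : ObjectProperty C} (hP : IsThickTensorIdeal P) (h : E ≤ P) :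
    thickTensorIdeal E ≤ P := fun _ hX => hX P hP h

lemma isThickTensorIdeal_thickTensorIdeal (E : ObjectProperty C) :
    IsThickTensorIdeal (thickTensorIdeal E) := by
  have hr : (thickTensorIdeal E).IsStableUnderRetracts :=
    ⟨fun r hY P hP h => have := hP.retracts; P.prop_of_retract r (hY P hP h)⟩
  refine ⟨?_, hr, fun X _ hY P hP h => hP.tensor X (hY P hP h)⟩
  exact {
    exists_zero := ⟨0, isZero_zero C, fun P hP h => by
      have := hP.triangulated
      have := hP.retracts
      exact P.prop_zero⟩
    isStableUnderShiftBy := fun n => ⟨fun X hX P hP h => by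
      have := hP.triangulated
      exact P.le_shift n _ (hX P hP h)⟩
    ext₂' := fun T hT h₁ h₃ => ObjectProperty.le_isoClosure _ _ fun P hP h => by
      have := hP.triangulated
      have := hP.retracts
      exact P.ext_of_isTriangulatedClosed₂ T hT (h₁ P hP h) (h₃ P hP h) }

namespace IsThickTensorIdeal

variable {P : ObjectProperty C} {X Y : C} {i j k : ℤ}

lemma tensor_left (hP : IsThickTensorIdeal P) (Y : C) (h : P X) : P (X ⊗ Y) := by
  have := hP.retracts
  exact P.prop_of_iso (β_ Y X) (hP.tensor Y h)

lemma trW_conj (α : X ≅ Y) (f : GEnd X i) : P.trW (GEnd.conj α f) ↔ P.trW f := by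
  simp only [GEnd.conj]
  rw [P.trW.cancel_left_of_respectsIso, P.trW.cancel_right_of_respectsIso]

lemma trW_mul (hP : IsThickTensorIdeal P) {f : GEnd X i} {g : GEnd X j} (h : i + j = k)
    (hf : P.trW f) (hg : P.trW g) : P.trW (f.mul g h) := by
  have := hP.triangulated
  simp only [GEnd.mul]
  rw [P.trW.cancel_left_of_respectsIso]
  exact P.trW.comp_mem _ _ (hg.shift i) hf

lemma trW_one (hP : IsThickTensorIdeal P) (X : C) : P.trW (GEnd.one X) := by
  have := hP.triangulated
  exact P.trW_of_isIso ((shiftFunctorZero C ℤ).hom.app X)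

lemma of_trW_zero (hP : IsThickTensorIdeal P) {X Y : C} (h : P.trW (0 : X ⟶ Y)) : P Y := by
  have := hP.retracts
  obtain ⟨Z, a, b, hT, hZ⟩ := h
  obtain ⟨r, hr⟩ := Triangle.yoneda_exact₂ _ hT (𝟙 Y) zero_comp
  exact P.prop_of_retract ⟨a, r, hr.symm⟩ hZ

/-- The triangle obtained by tensoring a distinguished triangle with an object. -/
lemma tensorRight_triangle {X Y Z : C} {f : X ⟶ Y} {a : Y ⟶ Z} {b : Z ⟶ X⟦(1 : ℤ)⟧}
    (hT : Triangle.mk f a b ∈ distTriang C) (W : C) :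
    Triangle.mk (f ▷ W) (a ▷ W) (b ▷ W ≫ (suspLeft X W 1).hom) ∈ distTriang C := by
  have := TensorTriangulated.exact_tensorRight W
  exact (tensorRight W).map_distinguished _ hT

lemma trW_tensorR_iff (hP : IsThickTensorIdeal P) {f : GEnd X i} {c : C} {a : X ⟶ c}
    {b : c ⟶ X⟦i⟧⟦(1 : ℤ)⟧} (hT : Triangle.mk f a b ∈ distTriang C) (Y : C) :
    P.trW (f.tensorR Y) ↔ P (c ⊗ Y) := by
  have := hP.triangulated
  have := hP.retracts
  simp only [GEnd.tensorR]
  rw [P.trW.cancel_left_of_respectsIso]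
  exact P.trW_iff_of_distinguished _ (tensorRight_triangle hT Y)

lemma trW_tensorR (hP : IsThickTensorIdeal P) {f : GEnd X i} (hf : P.trW f) (Y : C) :
    P.trW (f.tensorR Y) := by
  obtain ⟨c, a, b, hT, hc⟩ := hf
  exact (hP.trW_tensorR_iff hT Y).2 (hP.tensor_left Y hc)

end IsThickTensorIdeal

namespace GEnd

variable {X : C} {i k : ℤ}

lemma shiftComm_self (X : C) (i : ℤ) : (shiftComm X i i).hom = 𝟙 _ := by
  simp [shiftComm, shiftFunctorComm_eq C i i (i + i) rfl]

lemma coyoneda_exact {X Y Z W : C} {f : X ⟶ Y} {a : Y ⟶ Z} {b : Z ⟶ X⟦(1 : ℤ)⟧}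
    (hT : Triangle.mk f a b ∈ distTriang C) (φ : W ⟶ Z) (h : φ ≫ b = 0) : ∃ w, φ = w ≫ a :=
  Triangle.coyoneda_exact₃ _ hT φ h

lemma suspRight_natural_right (X : C) {Y Y' : C} (g : Y ⟶ Y') (n : ℤ) :
    X ◁ (g⟦n⟧') ≫ (suspRight X Y' n).hom = (suspRight X Y n).hom ≫ (X ◁ g)⟦n⟧' := by
  simp only [suspRight, Iso.trans_hom, Functor.mapIso_hom, Category.assoc,
    BraidedCategory.braiding_naturality_right_assoc, reassoc_of% suspLeft_natural_left,
    ← Functor.map_comp, BraidedCategory.braiding_naturality_left]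

lemma killscone_aux {f : GEnd X i} (hf : f.Balanced) :
    f ▷ (X⟦i⟧) ≫ (suspRight X X i).hom =
      (i * i).negOnePow • (X⟦i⟧ ◁ f ≫ (suspLeft X X i).hom) := by
  have hf' : f ▷ X = (suspLeft X X i).hom ≫ (suspRight X X i).inv ≫ X ◁ f := by
    rw [← Iso.inv_comp_eq]; exact hf
  have h := TensorTriangulated.susp_anticomm X X i i
  rw [shiftComm_self, Category.comp_id] at h
  have h' : (suspRight (X⟦i⟧) X i).hom ≫ (suspLeft X X i).hom⟦i⟧' =
      (i * i).negOnePow • ((suspLeft X (X⟦i⟧) i).hom ≫ (suspRight X X i).hom⟦i⟧') := by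
    rw [h, smul_smul, Int.units_mul_self, one_smul]
  rw [suspRight_natural_left, hf']
  simp only [Functor.map_comp, reassoc_of% h', Linear.units_smul_comp, Category.assoc]
  rw [← Functor.map_comp_assoc, Iso.hom_inv_id, CategoryTheory.Functor.map_id, Category.id_comp,
    TensorTriangulated.susp_natural]

/-- A balanced endomorphism acts nilpotently on its cone. -/
lemma killscone {f : GEnd X i} (hf : f.Balanced) {c : C} {a : X ⟶ c}
    {b : c ⟶ X⟦i⟧⟦(1 : ℤ)⟧} (hT : Triangle.mk f a b ∈ distTriang C) (h : i + i = k) :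
    (f.mul f h).tensorR c = 0 := by
  have hfa : f ≫ a = 0 := comp_distTriang_mor_zero₁₂ _ hT
  have hbf : b ≫ f⟦1⟧' = 0 := comp_distTriang_mor_zero₃₁ _ hT
  have hf' : f ▷ X = (suspLeft X X i).hom ≫ (suspRight X X i).inv ≫ X ◁ f := by
    rw [← Iso.inv_comp_eq]; exact hf
  have h₁ : X⟦i⟧ ◁ a ≫ f ▷ c = 0 := by
    rw [whisker_exchange, hf']
    simp [← whiskerLeft_comp, hfa]
  have h₂ : f ▷ c ≫ X ◁ b = 0 := by
    rw [← whisker_exchange, ← cancel_mono (suspRight X (X⟦i⟧) 1).hom,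
      ← cancel_mono ((suspRight X X i).hom⟦(1 : ℤ)⟧')]
    simp only [Category.assoc, zero_comp, reassoc_of% suspRight_natural_left, ← Functor.map_comp]
    rw [killscone_aux hf, Functor.map_units_smul, Linear.comp_units_smul, Linear.comp_units_smul,
      Functor.map_comp, ← reassoc_of% suspRight_natural_right, ← whiskerLeft_comp_assoc, hbf]
    simp
  obtain ⟨w, hw⟩ : ∃ w, f ▷ c = w ≫ X ◁ a := by
    obtain ⟨w, hw⟩ := coyoneda_exact (IsThickTensorIdeal.tensorRight_triangle hT X)
      (f ▷ c ≫ (β_ X c).hom) (by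
        rw [Category.assoc, ← BraidedCategory.braiding_naturality_right_assoc, reassoc_of% h₂,
          zero_comp])
    refine ⟨w ≫ (β_ X X).hom, ?_⟩
    rw [← cancel_mono (β_ X c).hom, hw]
    simp
  have h₃ : (X ◁ a)⟦i⟧' ≫ (suspLeft X c i).inv = (suspLeft X X i).inv ≫ X⟦i⟧ ◁ a := by
    rw [← cancel_epi (suspLeft X X i).hom, ← cancel_mono (suspLeft X c i).hom]
    simp [TensorTriangulated.susp_natural X a i]
  rw [tensorR_mul]
  simp only [mul, tensorR, Functor.map_comp, Category.assoc]
  nth_rewrite 1 [hw]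
  simp only [Functor.map_comp, Category.assoc, reassoc_of% h₃, h₁, comp_zero]

lemma conj_zero {Y : C} (α : X ≅ Y) : conj α (0 : GEnd X i) = 0 := by simp [conj]

lemma smul_mul {j l : ℤ} (ε : ℤˣ) (f : GEnd X i) (g : GEnd X j) (h : i + j = l) :
    (ε • f).mul g h = ε • f.mul g h := by simp [mul, Linear.comp_units_smul]

lemma mul_smul {j l : ℤ} (ε : ℤˣ) (f : GEnd X i) (g : GEnd X j) (h : i + j = l) :
    f.mul (ε • g) h = ε • f.mul g h := by
  simp [mul, Linear.comp_units_smul, Linear.units_smul_comp, Functor.map_units_smul]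

lemma conj_smul {Y : C} (α : X ≅ Y) (ε : ℤˣ) (f : GEnd X i) : conj α (ε • f) = ε • conj α f := by
  simp [conj, Linear.comp_units_smul, Linear.units_smul_comp]

lemma tensorR_smul (ε : ℤˣ) (f : GEnd X i) (Y : C) : (ε • f).tensorR Y = ε • f.tensorR Y := by
  rcases Int.units_eq_one_or ε with rfl | rfl
  · simp
  · simp only [Units.neg_smul, one_smul, tensorR_neg]

lemma tensorR_eq_zero_left {f : GEnd X i} {c : C} (h : f.tensorR c = 0) (d : C) :
    f.tensorR (c ⊗ d) = 0 := by
  rw [← conj_assoc_tensorR, h, tensorR_zero, conj_zero]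

lemma tensorR_eq_zero_right {f : GEnd X i} {d : C} (h : f.tensorR d = 0) (c : C) :
    f.tensorR (c ⊗ d) = 0 := by
  rw [← conj_tensorR_right f (β_ d c), tensorR_eq_zero_left h, conj_zero]

/-- Balanced endomorphisms of `X` commute up to sign after tensoring with `X`. -/
lemma tensorR_comm {j l : ℤ} (f : GEnd X i) {g : GEnd X j} (hg : g.Balanced) (h : i + j = l)
    (Y : C) : (f.tensorR (X ⊗ Y)).mul (g.tensorR (X ⊗ Y)) h =
      (i * j).negOnePow • (g.tensorR (X ⊗ Y)).mul (f.tensorR (X ⊗ Y)) (by omega) := by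
  have key := mul_tensorL_tensorR f g h
  rw [← hg, ← tensorR_mul, ← tensorR_mul] at key
  rw [← tensorR_mul, ← tensorR_mul, ← conj_assoc_tensorR, key, tensorR_smul, conj_smul,
    conj_assoc_tensorR]

end GEnd

/-- A point of the spectrum: a prime ideal, that is, a proper thick `⊗`-ideal `𝒫` such that
`X ⊗ Y ∈ 𝒫` implies `X ∈ 𝒫` or `Y ∈ 𝒫`. -/
structure Spc (C : Type u) [Category.{v} C] [Preadditive C] [HasZeroObject C]
    [HasShift C ℤ] [∀ n : ℤ, (shiftFunctor C n).Additive] [Pretriangulated C] [IsTriangulated C]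
    [MonoidalCategory C] [SymmetricCategory C] [MonoidalPreadditive C]
    [TensorTriangulated C] where
  carrier : ObjectProperty C
  thick : IsThickTensorIdeal carrier
  proper : ∃ X, ¬ carrier X
  prime {X Y : C} : carrier (X ⊗ Y) → carrier X ∨ carrier Y

namespace Spc

/-- The support of an object. -/
def supp (X : C) : Set (Spc C) := {P | ¬ P.carrier X}

/-- The topology with the supports of objects as a basis of closed sets. -/
instance : TopologicalSpace (Spc C) :=
  TopologicalSpace.generateFrom {U | ∃ X : C, U = (supp X)ᶜ}

variable (P : Spc C) {X : C} {i j k : ℤ}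

lemma exists_cone (P : Spc C) {f : GEnd X i} (hf : ¬ P.carrier.trW f) :
    ∃ (c : C) (a : X ⟶ c) (b : c ⟶ X⟦i⟧⟦(1 : ℤ)⟧), Triangle.mk f a b ∈ distTriang C ∧
      ¬ P.carrier c := by
  obtain ⟨c, a, b, hT⟩ := distinguished_cocone_triangle f
  exact ⟨c, a, b, hT, fun hc => hf ⟨c, a, b, hT, hc⟩⟩

lemma not_tensor (P : Spc C) {X Y : C} (hX : ¬ P.carrier X) (hY : ¬ P.carrier Y) :
    ¬ P.carrier (X ⊗ Y) := fun h => (P.prime h).elim hX hY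

lemma trW_tensorR_iff (P : Spc C) {Y : C} (hY : ¬ P.carrier Y) (f : GEnd X i) :
    P.carrier.trW (f.tensorR Y) ↔ P.carrier.trW f := by
  refine ⟨fun h => ?_, fun h => P.thick.trW_tensorR h Y⟩
  by_contra hf
  obtain ⟨c, a, b, hT, hc⟩ := P.exists_cone hf
  exact P.not_tensor hc hY ((P.thick.trW_tensorR_iff hT Y).1 h)

lemma trW_tensorL_iff (P : Spc C) {Y : C} (hY : ¬ P.carrier Y) (f : GEnd X i) :
    P.carrier.trW (GEnd.tensorL Y f) ↔ P.carrier.trW f := by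
  rw [GEnd.tensorL_eq, IsThickTensorIdeal.trW_conj, P.trW_tensorR_iff hY]

lemma trW_of_add (P : Spc C) (hX : ¬ P.carrier X) {f g : GEnd X i} (hf : f.Balanced)
    (hg : g.Balanced) (h : P.carrier.trW (f + g)) : P.carrier.trW f ∨ P.carrier.trW g := by
  by_contra! hfg
  obtain ⟨c, a, b, hT, hc⟩ := P.exists_cone hfg.1
  obtain ⟨d, a', b', hT', hd⟩ := P.exists_cone hfg.2
  set E := X ⊗ (c ⊗ d) with hE
  set F := f.tensorR E with hF
  set G := g.tensorR E with hG
  have hFF : F.mul F rfl = 0 := by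
    rw [hF, ← GEnd.tensorR_mul]
    exact GEnd.tensorR_eq_zero_right
      (GEnd.tensorR_eq_zero_left (GEnd.killscone hf hT rfl) d) X
  have hGG : G.mul G rfl = 0 := by
    rw [hG, ← GEnd.tensorR_mul]
    exact GEnd.tensorR_eq_zero_right
      (GEnd.tensorR_eq_zero_right (GEnd.killscone hg hT' rfl) c) X
  have hFG : F.mul G rfl = (i * i).negOnePow • G.mul F rfl := GEnd.tensorR_comm f hg rfl _
  have hGF : G.mul F rfl = (i * i).negOnePow • F.mul G rfl := GEnd.tensorR_comm g hf rfl _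
  have hW : P.carrier.trW (F + G) := by
    rw [hF, hG, ← GEnd.tensorR_add]
    exact P.thick.trW_tensorR h E
  have h₁ : F.mul (F.mul G rfl) rfl = 0 := by
    rw [← GEnd.mul_assoc' F F G rfl rfl (by omega), hFF, GEnd.zero_mul]
  have h₂ : G.mul (G.mul F rfl) rfl = 0 := by
    rw [← GEnd.mul_assoc' G G F rfl rfl (by omega), hGG, GEnd.zero_mul]
  have h₃ : F.mul (G.mul F rfl) rfl = 0 := by rw [hGF, GEnd.mul_smul, h₁, smul_zero]
  have h₄ : G.mul (F.mul G rfl) rfl = 0 := by rw [hFG, GEnd.mul_smul, h₂, smul_zero]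
  have h₅ : (F + G).mul ((F + G).mul (F + G) rfl) rfl = 0 := by
    simp only [GEnd.add_mul, GEnd.mul_add, hFF, hGG, h₁, h₂, h₃, h₄, GEnd.mul_zero, add_zero]
  have h₆ := P.thick.trW_mul rfl hW (P.thick.trW_mul rfl hW hW)
  rw [h₅] at h₆
  exact P.not_tensor hX (P.not_tensor hX (P.not_tensor hc hd)) (P.thick.of_trW_zero h₆)

lemma trW_of_mul (P : Spc C) (hX : ¬ P.carrier X) {f : GEnd X i} {g : GEnd X j} (hf : f.Balanced)
    (hij : i + j = k) (h : P.carrier.trW (f.mul g hij)) : P.carrier.trW f := by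
  by_contra hfW
  obtain ⟨c, a, b, hT, hc⟩ := P.exists_cone hfW
  set E := X ⊗ c with hE
  set F := f.tensorR E with hF
  set G := g.tensorR E with hG
  have hFF : F.mul F rfl = 0 := by
    rw [hF, ← GEnd.tensorR_mul]
    exact GEnd.tensorR_eq_zero_right (GEnd.killscone hf hT rfl) X
  have hGF : G.mul F rfl = (j * i).negOnePow • F.mul G (by omega) := GEnd.tensorR_comm g hf rfl _
  have hW : P.carrier.trW (F.mul G hij) := by
    rw [hF, hG, ← GEnd.tensorR_mul]
    exact P.thick.trW_tensorR h E
  have h₁ : F.mul (F.mul G (show i + j = j + i by omega)) (show i + (j + i) = k + i by omega) = 0 := by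
    rw [← GEnd.mul_assoc' F F G rfl (by omega) (by omega), hFF, GEnd.zero_mul]
  have h₂ : (F.mul G hij).mul F rfl = 0 := by
    rw [GEnd.mul_assoc' F G F hij rfl rfl, hGF, GEnd.mul_smul, h₁, smul_zero]
  have h₃ : (F.mul G hij).mul (F.mul G hij) rfl = 0 := by
    rw [← GEnd.mul_assoc' (F.mul G hij) F G rfl hij (by omega), h₂, GEnd.zero_mul]
  have h₄ := P.thick.trW_mul rfl hW hW
  rw [h₃] at h₄
  exact P.not_tensor hX (P.not_tensor hX hc) (P.thick.of_trW_zero h₄)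

end Spc

end Ideals

section HomogeneousSpectrum

/-- A homogeneous prime ideal of a `ℤ`-graded ring, given by its homogeneous parts. -/
structure Spech (A : ℤ → Type*) [∀ i, AddCommGroup (A i)] [DirectSum.GRing A] where
  carrier (i : ℤ) : AddSubgroup (A i)
  mul_mem_left {i j : ℤ} (x : A i) {y : A j} : y ∈ carrier j →
    GradedMonoid.GMul.mul x y ∈ carrier (i + j)
  mul_mem_right {i j : ℤ} {x : A i} (y : A j) : x ∈ carrier i →
    GradedMonoid.GMul.mul x y ∈ carrier (i + j)
  one_notMem : (GradedMonoid.GOne.one : A 0) ∉ carrier 0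
  mem_or_mem {i j : ℤ} {x : A i} {y : A j} : GradedMonoid.GMul.mul x y ∈ carrier (i + j) →
    x ∈ carrier i ∨ y ∈ carrier j

variable {A : ℤ → Type*} [∀ i, AddCommGroup (A i)] [DirectSum.GRing A]

/-- The Zariski topology: the sets of primes that do not contain a given homogeneous element form
a basis of open sets. -/
instance : TopologicalSpace (Spech A) :=
  TopologicalSpace.generateFrom {U | ∃ (i : ℤ) (x : A i), U = {p | x ∉ p.carrier i}}

/-- `𝔭 ∩ S = ∅`, for a set `S` of homogeneous elements. -/
def Spech.Avoids (p : Spech A) (S : Set (⨁ i, A i)) : Prop :=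
  ∀ (i : ℤ) (x : A i), DirectSum.of A i x ∈ S → x ∉ p.carrier i

end HomogeneousSpectrum

lemma units_smul_mem_iff {G : Type*} [AddCommGroup G] (H : AddSubgroup G) (ε : ℤˣ)
    (x : G) : ε • x ∈ H ↔ x ∈ H := by
  rcases Int.units_eq_one_or ε with rfl | rfl
  · rw [one_smul]
  · rw [Units.neg_smul, one_smul, neg_mem_iff]

section Comparison

variable {C : Type u} [Category.{v} C] [Preadditive C] [HasZeroObject C]
    [HasShift C ℤ] [∀ n : ℤ, (shiftFunctor C n).Additive] [Pretriangulated C] [IsTriangulated C]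
    [MonoidalCategory C] [SymmetricCategory C] [MonoidalPreadditive C] [TensorTriangulated C]

/-- The subspace `⋂_{X ∈ Φ} supp X` of the spectrum. -/
def Z (Φ : TensorSet C) : Set (Spc C) := ⋂ X ∈ {X : C | Φ.carrier X}, Spc.supp X

variable {Φ : TensorSet C} {i j k : ℤ}

lemma Z.notMem {Φ : TensorSet C} (P : Z Φ) {X : C} (hX : Φ.carrier X) : ¬ P.1.carrier X :=
  Set.mem_iInter₂.1 P.2 X hX

/-- `cone f ∈ 𝒫`, as a property of the class `[f]`. -/
def R.ConeMem (P : Z Φ) : R Φ i → Prop :=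
  Quot.lift (fun x => P.1.carrier.trW x.hom) (by
    rintro x y (⟨a, ha⟩ | ⟨a, ha⟩)
    · exact propext (P.1.trW_tensorL_iff (Z.notMem P ha) x.hom).symm
    · exact propext (P.1.trW_tensorR_iff (Z.notMem P ha) x.hom).symm)

lemma R.coneMem_mk (P : Z Φ) {X : C} (hX : Φ.carrier X) {f : GEnd X i} (hf : f.Balanced) :
    (R.mk X hX f hf).ConeMem P ↔ P.1.carrier.trW f := Iff.rfl

/-- The homogeneous part `{[f] | cone f ∉ 𝒫}` of degree `i`. -/
def rhoPart (P : Z Φ) (i : ℤ) : AddSubgroup (R Φ i) where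
  carrier := {x | ¬ x.ConeMem P}
  zero_mem' := by
    obtain ⟨X, hX⟩ := Φ.nonempty
    rw [← R.mk_zero hX]
    exact fun h => Z.notMem P hX (P.1.thick.of_trW_zero h)
  add_mem' := by
    intro x y hx hy
    obtain ⟨X, hX, f, g, hf, hg, rfl, rfl⟩ := R.exists₂ x y
    rw [R.mk_add]
    exact fun h => (P.1.trW_of_add (Z.notMem P hX) hf hg h).elim hx hy
  neg_mem' := by
    intro x hx
    induction x using R.ind with | h X hX f hf => _
    intro h
    have h' : P.1.carrier.trW (-f) := h
    have := P.1.carrier.smul_mem_trW_iff f (-1)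
    rw [Units.neg_smul, one_smul] at this
    exact hx (this.1 h')

/-- The comparison map `𝒫 ↦ {[f] | cone f ∉ 𝒫}`. -/
noncomputable def rho (Φ : TensorSet C) (P : Z Φ) : Spech (R Φ) where
  carrier := rhoPart P
  mul_mem_left x y hy := by
    obtain ⟨X, hX, f, g, hf, hg, rfl, rfl⟩ := R.exists₂ x y
    rw [R.gMul_eq, R.mul_comm', R.mk_mul, units_smul_mem_iff]
    exact fun h => hy (P.1.trW_of_mul (Z.notMem P hX) hg (add_comm _ _) h)
  mul_mem_right {_ _ x} y hx := by
    obtain ⟨X, hX, f, g, hf, hg, rfl, rfl⟩ := R.exists₂ x y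
    rw [R.gMul_eq, R.mk_mul]
    exact fun h => hx (P.1.trW_of_mul (Z.notMem P hX) hf rfl h)
  one_notMem := by
    obtain ⟨X, hX⟩ := Φ.nonempty
    change ¬ ¬ (R.one : R Φ 0).ConeMem P
    rw [← R.mk_one hX]
    exact not_not_intro (P.1.thick.trW_one X)
  mem_or_mem {_ _ x y} h := by
    obtain ⟨X, hX, f, g, hf, hg, rfl, rfl⟩ := R.exists₂ x y
    by_contra! h'
    rw [R.gMul_eq, R.mk_mul] at h
    exact h (P.1.thick.trW_mul rfl (not_not.1 h'.1) (not_not.1 h'.2))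

lemma mem_rho (P : Z Φ) {X : C} (hX : Φ.carrier X) {f : GEnd X i} (hf : f.Balanced)
    {c : C} {a : X ⟶ c} {b : c ⟶ X⟦i⟧⟦(1 : ℤ)⟧} (hT : Triangle.mk f a b ∈ distTriang C) :
    R.mk X hX f hf ∈ (rho Φ P).carrier i ↔ ¬ P.1.carrier c := by
  have := P.1.thick.triangulated
  have := P.1.thick.retracts
  exact not_congr (P.1.carrier.trW_iff_of_distinguished _ hT)

end Comparison

section Quotient

variable {C : Type u} [Category.{v} C] [Preadditive C] [HasZeroObject C]
    [HasShift C ℤ] [∀ n : ℤ, (shiftFunctor C n).Additive] [Pretriangulated C] [IsTriangulated C]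
    [MonoidalCategory C] [SymmetricCategory C] [MonoidalPreadditive C] [TensorTriangulated C]
    {D : Type u'} [Category.{v'} D] [Preadditive D] [HasZeroObject D]
    [HasShift D ℤ] [∀ n : ℤ, (shiftFunctor D n).Additive] [Pretriangulated D] [IsTriangulated D]
    [MonoidalCategory D] [SymmetricCategory D] [MonoidalPreadditive D] [TensorTriangulated D]

open Functor.Monoidal

/-- The cones of the representatives of the elements of a set of homogeneous elements. -/
def conesOf {Φ : TensorSet C} (S : Set (⨁ i, R Φ i)) : ObjectProperty C := fun c =>
  ∃ (i : ℤ) (X : C) (hX : Φ.carrier X) (f : GEnd X i) (hf : f.Balanced) (a : X ⟶ c)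
    (b : c ⟶ X⟦i⟧⟦(1 : ℤ)⟧), DirectSum.of (R Φ) i (R.mk X hX f hf) ∈ S ∧
      Triangle.mk f a b ∈ distTriang C

variable (F : C ⥤ D) [F.CommShift ℤ] [F.Braided] [IsTensorTriangulated F]

/-- `F⁻¹ : Spc D → Spc C`. -/
def Spc.comap (Q : Spc D) : Spc C where
  carrier := Q.carrier.inverseImage F
  thick := by
    have := Q.thick.triangulated
    have := Q.thick.retracts
    exact {
      triangulated := inferInstance
      retracts := ⟨fun r h => Q.carrier.prop_of_retract (r.map F) h⟩
      tensor := fun X Y h => Q.carrier.prop_of_iso (μIso F X Y) (Q.thick.tensor _ h) }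
  proper := by
    obtain ⟨X, hX⟩ := Q.proper
    have := Q.thick.retracts
    refine ⟨𝟙_ C, fun h => hX ?_⟩
    exact Q.carrier.prop_of_iso (ρ_ X) (Q.thick.tensor X
      (Q.carrier.prop_of_iso (εIso F).symm h))
  prime {X Y} h := by
    have := Q.thick.retracts
    exact Q.prime (Q.carrier.prop_of_iso (μIso F X Y).symm h)

/-- The map `Z (F Φ) → Z Φ` induced by `F⁻¹ : Spc D → Spc C`. -/
def Z.comap (Φ : TensorSet C) (Q : Z (Φ.map F)) : Z Φ :=
  ⟨Spc.comap F Q.1, Set.mem_iInter₂.2 fun _ hX => Z.notMem Q (Φ.map_mem F hX)⟩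

/-- The map on homogeneous spectra induced by `[f] ↦ [F f]`. -/
noncomputable def Spech.comapR (Φ : TensorSet C) (p : Spech (R (Φ.map F))) : Spech (R Φ) where
  carrier i := (p.carrier i).comap (R.mapAdd F Φ i)
  mul_mem_left {i j} x y hy := by
    rw [AddSubgroup.mem_comap, R.gMul_eq, R.mapAdd_mul]
    exact p.mul_mem_left _ hy
  mul_mem_right {i j x} y hx := by
    rw [AddSubgroup.mem_comap, R.gMul_eq, R.mapAdd_mul]
    exact p.mul_mem_right _ hx
  one_notMem := by
    change R.mapAdd F Φ 0 R.one ∉ p.carrier 0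
    rw [R.mapAdd_one]
    exact p.one_notMem
  mem_or_mem {i j x y} h := by
    rw [AddSubgroup.mem_comap, R.gMul_eq, R.mapAdd_mul] at h
    exact p.mem_or_mem h

/-- A multiplicative set of homogeneous elements of even degree satisfies the Ore conditions, as
its elements are central. -/
@[reducible]
def oreSet {Φ : TensorSet C} (S : Submonoid (⨁ i, R Φ i))
    (hS : ∀ s ∈ S, ∃ (i : ℤ) (x : R Φ i), Even i ∧ s = DirectSum.of (R Φ) i x) :
    OreLocalization.OreSet S :=
  have comm : ∀ (s : S) (r : ⨁ i, R Φ i), (s : ⨁ i, R Φ i) * r = r * s := fun s r => by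
    obtain ⟨i, x, hi, h⟩ := hS s s.2
    rw [h]
    exact R.central_of_even hi x r
  { ore_right_cancel := fun r₁ r₂ s h => ⟨s, by rw [comm, comm, h]⟩
    oreNum := fun r _ => r
    oreDenom := fun _ s => s
    ore_eq := fun r s => comm s r }

end Quotient

end TTLoc

open TTLoc

/-! The whole theorem rests on one fact: a balanced endomorphism acts nilpotently on its cone. More
precisely, `GEnd.killscone` says that `f²` vanishes after tensoring with the cone of `f`. The
objects on which some representative of an element of `S` acts as zero form a thick `⊗`-ideal
(`isThickTensorIdeal_killed`). This ideal contains the cones of all representatives `s`, since `s²`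
also represents an element of `S`. It therefore contains all of `𝒥`: every object of `𝒥` is
annihilated by a single element of `S`.

With this, the calculus of fractions in `𝒦/𝒥` becomes a calculus of fractions with denominators in
`S`. If `q f = 0`, then `f` factors through an object of `𝒥`, so an element of `S` annihilates `f`
(`exists_mul_tensorL_eq_zero`). A graded endomorphism `g` of `q X` is a roof `X⟦n⟧ ⟶ Z ⟵ X` whose
backward leg `w` has its cone in `𝒥`. An `s` that annihilates this cone factors through `w` after
tensoring with `Z`, which lifts the product `s g` to an endomorphism in `𝒦` (`exists_map_eq_mul`).
The lift need not be balanced, but its failure to be balanced is killed by `q`, hence by a further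
element of `S`; multiplying by that element gives a balanced lift (`R.exists_mapAdd_eq_mul`). So
every class over the quotient is a fraction `x / s`, classes that vanish there are killed by `S`,
and elements of `S` become invertible. These three facts characterize the localization.

On homogeneous spectra this gives the usual correspondence with the primes that avoid `S`. On
triangular spectra, the primes of `𝒦/𝒥` are the primes of `𝒦` that contain `𝒥`; a prime contains `𝒥`
as soon as it contains all the cones of representatives of elements of `S`, which says exactly that
its image under `ρ` avoids `S`. Both rows thus have ranges cut out by the same condition, and the
square is cartesian because it commutes and the bottom row is injective. -/

namespace TTLoc

/-! ### Thick subcategories and Verdier quotients -/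

section VerdierQuotient

variable {C : Type u} [Category.{v} C] [Preadditive C] [HasZeroObject C]
    [HasShift C ℤ] [∀ n : ℤ, (shiftFunctor C n).Additive] [Pretriangulated C] [IsTriangulated C]

/-- The kernel of a Verdier quotient functor is the subcategory it is the quotient by. -/
lemma isZero_localization_iff (P : ObjectProperty C) [P.IsTriangulated]
    [P.IsStableUnderRetracts] (X : C) : IsZero (P.trW.Q.obj X) ↔ P X := by
  constructor
  · intro h
    -- In the quotient `𝟙 X` and `0` agree, so they already agree after precomposition with some `w`
    -- of the localized class. Then `w = 0`, the next map in its triangle is a split monomorphism,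
    -- and `X` is a retract of the cone.
    obtain ⟨Z, w, hw, e⟩ := (MorphismProperty.map_eq_iff_precomp P.trW.Q P.trW (𝟙 X) 0).1
      (h.eq_of_src _ _)
    obtain rfl : w = 0 := by simpa using e
    obtain ⟨c, a, b, hT, hc⟩ := hw
    obtain ⟨r, hr⟩ := Triangle.yoneda_exact₂ _ hT (𝟙 X) zero_comp
    exact P.prop_of_retract ⟨a, r, hr.symm⟩ hc
  · intro h
    have hw : P.trW (0 : 0 ⟶ X) :=
      ⟨X, 𝟙 X, 0, contractible_distinguished₁ X, h⟩
    have := Localization.inverts P.trW.Q P.trW _ hw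
    exact IsZero.of_iso (P.trW.Q.map_isZero (isZero_zero C))
      (asIso (P.trW.Q.map (0 : 0 ⟶ X))).symm

lemma coyoneda_exact₂ {X Y Z W : C} {f : X ⟶ Y} {a : Y ⟶ Z} {b : Z ⟶ X⟦(1 : ℤ)⟧}
    (hT : Triangle.mk f a b ∈ distTriang C) (φ : W ⟶ Y) (h : φ ≫ a = 0) : ∃ w, φ = w ≫ f :=
  Triangle.coyoneda_exact₂ _ hT φ h

variable {D : Type u'} [Category.{v'} D] [Preadditive D] [HasZeroObject D]
    [HasShift D ℤ] [∀ n : ℤ, (shiftFunctor D n).Additive] [Pretriangulated D] [IsTriangulated D]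

/-- A thick subcategory containing `J` is the inverse image of a property of objects of the
quotient by `J`, that is stable under retracts. -/
lemma exists_inverseImage_eq (q : C ⥤ D) (J P : ObjectProperty C) [q.IsLocalization J.trW]
    [P.IsTriangulated] [P.IsStableUnderRetracts] (hJ : J ≤ P) :
    ∃ Q : ObjectProperty D, Q.IsStableUnderRetracts ∧ ∀ X, Q (q.obj X) ↔ P X := by
  -- As `J ≤ P`, the quotient functor by `P` factors through `q`. The kernel of the factorization is
  -- the property sought.
  have h : J.trW.IsInvertedBy P.trW.Q := fun _ _ f hf =>
    Localization.inverts P.trW.Q P.trW f (ObjectProperty.trW_monotone hJ _ hf)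
  refine ⟨fun Y => IsZero ((Localization.lift P.trW.Q h q).obj Y), ⟨fun r hY => ?_⟩, fun X => ?_⟩
  · exact (IsZero.iff_id_eq_zero _).2 (by
      have := (r.map (Localization.lift P.trW.Q h q)).retract
      rw [← this, hY.eq_of_tgt (r.map (Localization.lift P.trW.Q h q)).i 0, zero_comp])
  · rw [← isZero_localization_iff P X]
    exact ((Localization.fac P.trW.Q h q).app X).isZero_iff

/-- By the calculus of fractions, every morphism of the quotient is isomorphic, as an arrow, to the
image of a morphism of `C`. Hence every distinguished triangle of the quotient is isomorphic to the
image of one in `C`, where closure under extensions is known. -/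
lemma isTriangulated_of_inverseImage (q : C ⥤ D) [q.CommShift ℤ] [q.IsTriangulated]
    (W : MorphismProperty C) [q.IsLocalization W] [W.HasLeftCalculusOfFractions]
    (P : ObjectProperty C) [P.IsTriangulated] [P.IsStableUnderRetracts]
    (Q : ObjectProperty D) [Q.IsStableUnderRetracts] (h : ∀ X, Q (q.obj X) ↔ P X) :
    Q.IsTriangulated := by
  have := Localization.essSurj q W
  have := Localization.essSurj_mapArrow q W
  exact {
    exists_zero := ⟨q.obj 0, q.map_isZero (isZero_zero C), (h 0).2 P.prop_zero⟩
    isStableUnderShiftBy := fun n => ⟨fun Y hY => by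
      have hX := (h (q.objPreimage Y)).1 (Q.prop_of_iso (q.objObjPreimageIso Y).symm hY)
      exact Q.prop_of_iso ((q.commShiftIso n).app _ ≪≫
        (shiftFunctor D n).mapIso (q.objObjPreimageIso Y)) ((h _).2 (P.le_shift n _ hX))⟩
    ext₂' := fun T hT h₁ h₃ => ObjectProperty.le_isoClosure _ _ (by
      let g := q.mapArrow.objPreimage (Arrow.mk T.mor₁)
      let e := q.mapArrow.objObjPreimageIso (Arrow.mk T.mor₁)
      let e₁ := Arrow.leftFunc.mapIso e
      let e₂ := Arrow.rightFunc.mapIso e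
      obtain ⟨c, a, b, hc⟩ := distinguished_cocone_triangle g.hom
      have e₃ := isoTriangleOfIso₁₂ _ _ (q.map_distinguished _ hc) hT e₁ e₂
        (Arrow.w e.hom).symm
      have hA : P g.left := (h _).1 (Q.prop_of_iso e₁.symm h₁)
      have hc' : P c := (h _).1 (Q.prop_of_iso (Triangle.π₃.mapIso e₃).symm h₃)
      exact Q.prop_of_iso e₂ ((h _).2
        (P.ext_of_isTriangulatedClosed₂ _ hc hA hc'))) }

end VerdierQuotient

/-! ### Objects annihilated by elements of `S` -/

section

variable {C : Type u} [Category.{v} C] [Preadditive C] [HasZeroObject C]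
    [HasShift C ℤ] [∀ n : ℤ, (shiftFunctor C n).Additive] [Pretriangulated C] [IsTriangulated C]
    [MonoidalCategory C] [SymmetricCategory C] [MonoidalPreadditive C] [TensorTriangulated C]

/-- By the interchange law, `A ◁ b` followed by `s ▷ E` equals `s ▷ c` followed by `A ◁ b`. So
whatever factors through an object killed by `s` is itself killed by `s`. -/
lemma GEnd.mul_tensorL_of_eq_zero {A E : C} {i j k : ℤ} (s : GEnd A i) (t : GEnd E j)
    (h : i + j = k) {c : C} (a : E⟦j⟧ ⟶ c) (b : c ⟶ E) (ht : t = a ≫ b) (hc : s ▷ c = 0) :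
    (s.tensorR E).mul (tensorL A t) h = 0 := by
  have h₁ : (A ◁ b)⟦i⟧' ≫ (suspLeft A E i).inv = (suspLeft A c i).inv ≫ A⟦i⟧ ◁ b := by
    rw [← cancel_epi (suspLeft A c i).hom, ← cancel_mono (suspLeft A E i).hom]
    simp [TensorTriangulated.susp_natural A b i]
  subst ht
  simp only [mul, tensorL, tensorR, Functor.map_comp, MonoidalCategory.whiskerLeft_comp,
    Category.assoc, reassoc_of% h₁, whisker_exchange, hc, zero_comp, comp_zero]

lemma GEnd.tensorR_eq_zero_iff {A : C} {i : ℤ} (s : GEnd A i) (W : C) :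
    s.tensorR W = 0 ↔ s ▷ W = 0 := by
  rw [GEnd.tensorR]
  constructor
  · intro h
    rw [← cancel_epi (suspLeft A W i).inv, h, comp_zero]
  · intro h
    rw [h, comp_zero]

/-- The objects annihilated by a representative of an element of `S`. -/
def killed {Φ : TensorSet C} (S : Set (⨁ i, R Φ i)) : ObjectProperty C := fun W =>
  ∃ (i : ℤ) (A : C) (hA : Φ.carrier A) (s : GEnd A i) (hs : s.Balanced),
    DirectSum.of (R Φ) i (R.mk A hA s hs) ∈ S ∧ s ▷ W = 0

variable {Φ : TensorSet C}

lemma R.of_mk_mul_of_mk {i j k : ℤ} (h : i + j = k) {X Y : C} (hX : Φ.carrier X)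
    (hY : Φ.carrier Y) {f : GEnd X i} {g : GEnd Y j} (hf : f.Balanced) (hg : g.Balanced) :
    DirectSum.of (R Φ) i (mk X hX f hf) * DirectSum.of (R Φ) j (mk Y hY g hg) =
      DirectSum.of (R Φ) k (mk (X ⊗ Y) (Φ.tensor hX hY) ((f.tensorR Y).mul (GEnd.tensorL X g) h)
        ((hf.tensorR Y).mul (hg.tensorL X) h)) := by
  subst h
  rw [DirectSum.of_mul_of]
  rfl

/-- The point is closure under extensions, where the annihilators of the two outer terms multiply to
an annihilator of the middle one; this is why `S` has to be multiplicative. The element `1` takes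
care of the zero object. -/
lemma isThickTensorIdeal_killed (S : Submonoid (⨁ i, R Φ i)) :
    IsThickTensorIdeal (killed (S : Set (⨁ i, R Φ i))) := by
  have hr : (killed (S : Set (⨁ i, R Φ i))).IsStableUnderRetracts := ⟨by
    rintro W W' r ⟨i, A, hA, s, hs, hS, h0⟩
    refine ⟨i, A, hA, s, hs, hS, ?_⟩
    have : s ▷ W = A⟦i⟧ ◁ r.i ≫ s ▷ W' ≫ A ◁ r.r := by
      rw [← whisker_exchange, ← MonoidalCategory.whiskerLeft_comp_assoc, r.retract]; simp
    rw [this, h0, zero_comp, comp_zero]⟩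
  refine ⟨?_, hr, ?_⟩
  · exact {
      exists_zero := by
        refine ⟨0, isZero_zero C, 0, _, Φ.nonempty.choose_spec, _, GEnd.Balanced.one _,
          S.one_mem, ?_⟩
        exact ((tensorLeft _).map_isZero (isZero_zero C)).eq_of_tgt _ _
      isStableUnderShiftBy := fun n => ⟨by
        rintro W ⟨i, A, hA, s, hs, hS, h0⟩
        refine ⟨i, A, hA, s, hs, hS, ?_⟩
        rw [← cancel_mono (suspRight A W n).hom, GEnd.suspRight_natural_left, h0]
        simp⟩
      ext₂' := by
        rintro T hT ⟨i, A, hA, s, hs, hsS, h₁⟩ ⟨j, B, hB, t, ht, htS, h₃⟩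
        refine ObjectProperty.le_isoClosure _ _ ?_
        refine ⟨i + j, A ⊗ B, Φ.tensor hA hB, (s.tensorR B).mul (GEnd.tensorL A t) rfl,
          (hs.tensorR B).mul (ht.tensorL A) rfl, ?_, ?_⟩
        · rw [← R.of_mk_mul_of_mk rfl hA hB hs ht]
          exact S.mul_mem hsS htS
        rw [← GEnd.tensorR_eq_zero_iff, GEnd.tensorR_mul]
        apply GEnd.eq_of_conj (α_ A B T.obj₂)
        rw [GEnd.conj_mul, GEnd.conj_assoc_tensorR, GEnd.conj_assoc_mid, GEnd.conj_zero]
        -- As `t` kills the third object, `t ▷ T.obj₂` followed by `B ◁ T.mor₂` is zero, so it lifts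
        -- to the first object, which `s` kills. The braiding appears because the exactness used is
        -- that of tensoring on the right.
        obtain ⟨w, hw⟩ : ∃ w, t ▷ T.obj₂ = w ≫ B ◁ T.mor₁ := by
          have hT' := IsThickTensorIdeal.tensorRight_triangle (f := T.mor₁) (a := T.mor₂)
            (b := T.mor₃) hT B
          obtain ⟨w, hw⟩ := coyoneda_exact₂ hT' (t ▷ T.obj₂ ≫ (β_ B T.obj₂).hom) (by
            rw [Category.assoc, ← BraidedCategory.braiding_naturality_right,
              ← whisker_exchange_assoc, h₃]
            simp)
          refine ⟨w ≫ (β_ T.obj₁ B).hom, ?_⟩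
          rw [← cancel_mono (β_ B T.obj₂).hom, hw]
          simp
        refine GEnd.mul_tensorL_of_eq_zero s _ rfl ((suspLeft B T.obj₂ j).inv ≫ w) (B ◁ T.mor₁)
          (by rw [GEnd.tensorR, hw, Category.assoc]) ?_
        rw [← GEnd.tensorR_eq_zero_iff]
        exact GEnd.tensorR_eq_zero_right ((GEnd.tensorR_eq_zero_iff _ _).2 h₁) B }
  · rintro X W ⟨i, A, hA, s, hs, hS, h0⟩
    refine ⟨i, A, hA, s, hs, hS, ?_⟩
    rw [← GEnd.tensorR_eq_zero_iff] at h0 ⊢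
    exact GEnd.tensorR_eq_zero_right h0 X

/-- It suffices to treat the generators. The cone of `f` is annihilated by `f²`, by
`GEnd.killscone`, and the class of `f²` lies in `S` together with that of `f`. -/
lemma thickTensorIdeal_conesOf_le_killed (S : Submonoid (⨁ i, R Φ i)) :
    thickTensorIdeal (conesOf (S : Set (⨁ i, R Φ i))) ≤ killed (S : Set (⨁ i, R Φ i)) := by
  refine thickTensorIdeal_le (isThickTensorIdeal_killed S) ?_
  rintro c ⟨i, X, hX, f, hf, a, b, hS, hT⟩
  refine ⟨i + i, X, hX, f.mul f rfl, hf.mul hf rfl, ?_,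
    (GEnd.tensorR_eq_zero_iff _ _).1 (GEnd.killscone hf hT rfl)⟩
  have := S.mul_mem hS hS
  rwa [DirectSum.of_mul_of, R.gMul_eq, R.mk_mul] at this

end

end TTLoc

namespace TTLoc

/-! ### Vanishing of classes, graded inverses and balancedness -/

section

variable {C : Type u} [Category.{v} C] [Preadditive C] [HasZeroObject C]
    [HasShift C ℤ] [∀ n : ℤ, (shiftFunctor C n).Additive] [Pretriangulated C] [IsTriangulated C]
    [MonoidalCategory C] [SymmetricCategory C] [MonoidalPreadditive C] [TensorTriangulated C]

namespace R

variable {Φ : TensorSet C} {i j k : ℤ}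

/-- The class `[f]` vanishes as soon as `f` vanishes after tensoring with an object of `Φ`, and
conversely. -/
lemma mk_eq_zero_iff {X : C} (hX : Φ.carrier X) {f : GEnd X i} (hf : f.Balanced) :
    mk X hX f hf = 0 ↔ ∃ a, Φ.carrier a ∧ f.tensorR a = 0 := by
  constructor
  · intro h
    -- Vanishing after tensoring with some object of `Φ` is invariant under the generating relation,
    -- so it is a predicate on classes. It can then be evaluated on the zero representative.
    let Z : R Φ i → Prop := Quot.lift (fun x => ∃ a, Φ.carrier a ∧ x.hom.tensorR a = 0) (by
      have key : ∀ (x : Rep Φ i) (a b : C), x.hom.tensorR b = 0 →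
          (x.hom.tensorR a).tensorR b = 0 := fun x a b h0 => by
        apply GEnd.eq_of_conj (α_ x.obj a b)
        rw [GEnd.conj_assoc_tensorR, GEnd.tensorR_eq_zero_right h0, GEnd.conj_zero]
      have key' : ∀ (x : Rep Φ i) (a b : C), (x.hom.tensorR a).tensorR b = 0 →
          x.hom.tensorR (a ⊗ b) = 0 := fun x a b h0 => by
        rw [← GEnd.conj_assoc_tensorR, h0, GEnd.conj_zero]
      rintro x y (⟨a, ha⟩ | ⟨a, ha⟩)
      · refine propext ⟨fun ⟨b, hb, h0⟩ => ⟨b, hb, ?_⟩, fun ⟨b, hb, h0⟩ =>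
          ⟨a ⊗ b, Φ.tensor ha hb, key' x a b ?_⟩⟩
        · dsimp only [Rep.tensorL]
          rw [GEnd.tensorL_eq, GEnd.conj_tensorR_left, key x a b h0]
          exact GEnd.conj_zero _
        · dsimp only [Rep.tensorL] at h0
          rw [GEnd.tensorL_eq, GEnd.conj_tensorR_left] at h0
          exact GEnd.eq_of_conj _ (h0.trans (GEnd.conj_zero _).symm)
      · exact propext ⟨fun ⟨b, hb, h0⟩ => ⟨b, hb, key x a b h0⟩, fun ⟨b, hb, h0⟩ =>
          ⟨a ⊗ b, Φ.tensor ha hb, key' x a b h0⟩⟩)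
    have hZ : Z (mk X hX f hf) := by
      rw [h]
      exact ⟨_, Φ.nonempty.choose_spec, GEnd.tensorR_zero _ _⟩
    exact hZ
  · rintro ⟨a, ha, h⟩
    rw [← mk_tensorR a X ha hX f hf, mk_congr _ _ h, mk_zero]

lemma mk_mul_mk (h : i + j = k) {X Y : C} (hX : Φ.carrier X) (hY : Φ.carrier Y)
    {f : GEnd X i} {g : GEnd Y j} (hf : f.Balanced) (hg : g.Balanced) :
    mul h (mk X hX f hf) (mk Y hY g hg) = mk (X ⊗ Y) (Φ.tensor hX hY)
      ((f.tensorR Y).mul (GEnd.tensorL X g) h) ((hf.tensorR Y).mul (hg.tensorL X) h) := rfl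

lemma mul_assoc' {l m n : ℤ} (h₁ : i + j = l) (h₂ : j + k = m) (h₃ : l + k = n) (x : R Φ i)
    (y : R Φ j) (z : R Φ k) : mul h₃ (mul h₁ x y) z = mul (by omega) x (mul h₂ y z) := by
  obtain ⟨X, hX, f, g, h, hf, hg, hh, rfl, rfl, rfl⟩ := exists₃ x y z
  simp only [mk_mul]
  exact mk_congr _ _ (GEnd.mul_assoc' f g h h₁ h₂ h₃)

lemma one_mul' (x : R Φ i) : mul (zero_add i) one x = x := by
  induction x using ind with | h X hX f hf => _
  rw [← mk_one hX, mk_mul]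
  exact mk_congr _ _ (GEnd.one_mul' f)

lemma of_mul (h : i + j = k) (x : R Φ i) (y : R Φ j) :
    DirectSum.of (R Φ) k (mul h x y) = DirectSum.of (R Φ) i x * DirectSum.of (R Φ) j y := by
  subst h
  rw [DirectSum.of_mul_of]
  rfl

lemma mul_add' (h : i + j = k) (x : R Φ i) (y z : R Φ j) :
    mul h x (y + z) = mul h x y + mul h x z := by
  subst h
  exact DirectSum.GNonUnitalNonAssocSemiring.mul_add x y z

lemma mul_neg' (h : i + j = k) (x : R Φ i) (y : R Φ j) : mul h x (-y) = -mul h x y := by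
  subst h
  exact map_neg (DirectSum.gMulHom (R Φ) x) y

lemma mul_zero' (h : i + j = k) (x : R Φ i) : mul h x (0 : R Φ j) = 0 := by
  subst h
  exact DirectSum.GNonUnitalNonAssocSemiring.mul_zero x

lemma mul_smul' (h : i + j = k) (ε : ℤˣ) (x : R Φ i) (y : R Φ j) :
    mul h x (ε • y) = ε • mul h x y := by
  rcases Int.units_eq_one_or ε with rfl | rfl
  · simp only [one_smul]
  · simp only [Units.neg_smul, one_smul, mul_neg']

end R

namespace GEnd

variable {X Y : C} {i j k : ℤ}

lemma mul_left_injective_of_isIso (f : GEnd X i) [IsIso f] (h : i + j = k) {g g' : GEnd X j}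
    (e : f.mul g h = f.mul g' h) : g = g' := by
  simp only [mul] at e
  rw [cancel_epi, cancel_mono] at e
  exact (shiftFunctor C i).map_injective e

lemma isIso_tensorR (f : GEnd X i) [IsIso f] (Y : C) : IsIso (f.tensorR Y) := by
  rw [tensorR]
  infer_instance

/-- An invertible balanced endomorphism has a balanced graded inverse. -/
lemma Balanced.exists_inverse {f : GEnd X i} (hf : f.Balanced) [IsIso f] :
    ∃ g : GEnd X (-i), g.Balanced ∧ f.mul g (add_neg_cancel i) = GEnd.one X ∧
      g.mul f (neg_add_cancel i) = GEnd.one X := by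
  -- The equation `f · g = 1` prescribes `g⟦i⟧'`, and the shift is full.
  let g : GEnd X (-i) := (shiftFunctor C i).preimage
    ((shiftFunctorAdd' C (-i) i 0 (by omega)).inv.app X ≫ GEnd.one X ≫ inv f)
  have hfg : f.mul g (add_neg_cancel i) = GEnd.one X := by
    simp [g, GEnd.mul]
  have hgf : g.mul f (neg_add_cancel i) = GEnd.one X := by
    apply f.mul_left_injective_of_isIso (add_zero i)
    rw [← mul_assoc' f g f (add_neg_cancel i) _ (zero_add i), hfg, one_mul', mul_one']
  refine ⟨g, ?_, hfg, hgf⟩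
  have := f.isIso_tensorR X
  -- After multiplication by the invertible `f ⊗ X = X ⊗ f`, both `g ⊗ X` and `X ⊗ g` become the
  -- identity.
  apply (f.tensorR X).mul_left_injective_of_isIso (add_neg_cancel i)
  rw [← tensorR_mul, hfg, hf, ← tensorL_mul, hfg, tensorR_one, tensorL_one]

/-- If `h` is balanced up to multiplication by a balanced endomorphism `t`, then the product of `t`
and `h` is balanced. -/
lemma balanced_mul_of_eq {B : C} {t : GEnd B i} (ht : t.Balanced) (h : GEnd Y j)
    (hk : i + j = k) (e : (t.tensorR (Y ⊗ Y)).mul (GEnd.tensorL B (h.tensorR Y)) hk =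
      (t.tensorR (Y ⊗ Y)).mul (GEnd.tensorL B (GEnd.tensorL Y h)) hk) :
    ((t.tensorR Y).mul (GEnd.tensorL B h) hk).Balanced := by
  have e₁ : ((t.tensorR Y).tensorR Y).mul ((GEnd.tensorL B h).tensorR Y) hk =
      ((t.tensorR Y).tensorR Y).mul (GEnd.tensorL (B ⊗ Y) h) hk := by
    apply eq_of_conj (α_ B Y Y)
    rw [conj_mul, conj_mul, conj_assoc_tensorR, conj_assoc_mid, conj_assoc_tensorL, e]
  -- Tensoring with `B` and moving it into place produces the identity on `(B ⊗ Y) ⊗ (B ⊗ Y)`, where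
  -- balancedness of the product is tested. Only the balancedness of `t ⊗ Y` is then left to use.
  have e₂ := congrArg (fun f => conj (whiskerLeftIso (B ⊗ Y) (β_ Y B))
    (conj (α_ (B ⊗ Y) Y B) (GEnd.tensorR f B))) e₁
  simp only [tensorR_mul, conj_mul, conj_assoc_tensorR, conj_assoc_mid, conj_tensorR_right,
    ← conj_tensorL_right, ← tensorL_eq] at e₂
  rw [Balanced, tensorR_mul, e₂, tensorL_mul, ht.tensorR Y]

end GEnd

end

/-! ### Fullness and faithfulness of the quotient functor up to `S` -/

section

variable {C : Type u} [Category.{v} C] [Preadditive C] [HasZeroObject C]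
    [HasShift C ℤ] [∀ n : ℤ, (shiftFunctor C n).Additive] [Pretriangulated C] [IsTriangulated C]
    [MonoidalCategory C] [SymmetricCategory C] [MonoidalPreadditive C] [TensorTriangulated C]
    {D : Type u'} [Category.{v'} D] [Preadditive D] [HasZeroObject D]
    [HasShift D ℤ] [∀ n : ℤ, (shiftFunctor D n).Additive] [Pretriangulated D] [IsTriangulated D]
    [MonoidalCategory D] [SymmetricCategory D] [MonoidalPreadditive D] [TensorTriangulated D]
    (q : C ⥤ D) [q.CommShift ℤ] [q.Braided] [IsTensorTriangulated q]

open Functor.LaxMonoidal Functor.OplaxMonoidal Functor.Monoidal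

/-- This extends `GEnd.map_mul` to graded morphisms between different objects; the numerator of a
roof is not an endomorphism. -/
lemma map_gradedComp {X Y Z : C} {i j k : ℤ} (h : j + i = k) (r : X⟦j⟧ ⟶ Y) (t : Y⟦i⟧ ⟶ Z) :
    (q.commShiftIso k).inv.app X ≫
      q.map ((shiftFunctorAdd' C j i k h).hom.app X ≫ r⟦i⟧' ≫ t) =
    (shiftFunctorAdd' D j i k h).hom.app (q.obj X) ≫
      ((q.commShiftIso j).inv.app X ≫ q.map r)⟦i⟧' ≫ (q.commShiftIso i).inv.app Y ≫ q.map t := by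
  have e := NatTrans.congr_app (congr_arg Iso.inv (q.commShiftIso_add' h)) X
  simp only [Functor.CommShift.isoAdd'_inv_app] at e
  have nat := (q.commShiftIso i).inv.naturality r
  simp only [Functor.comp_map] at nat
  have c : q.map ((shiftFunctorAdd' C j i k h).inv.app X) ≫
      q.map ((shiftFunctorAdd' C j i k h).hom.app X) = 𝟙 _ := by
    rw [← q.map_comp, Iso.inv_hom_id_app, q.map_id]
  simp only [e, q.map_comp, Functor.map_comp, Category.assoc, reassoc_of% c]
  rw [reassoc_of% nat]

/-- The right suspension isomorphism is the left one conjugated by the braiding, and `q` is braided.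
-/
lemma susp_comm_right (X Y : C) (n : ℤ) :
    μ q X (Y⟦n⟧) ≫ q.map (suspRight X Y n).hom ≫ (q.commShiftIso n).hom.app (X ⊗ Y) =
      q.obj X ◁ (q.commShiftIso n).hom.app Y ≫ (suspRight (q.obj X) (q.obj Y) n).hom ≫
        (μ q X Y)⟦n⟧' := by
  have h := IsTensorTriangulated.susp_comm (F := q) Y X n
  have nat := (q.commShiftIso n).hom.naturality (β_ Y X).hom
  simp only [Functor.comp_map] at nat
  have nb : q.obj X ◁ (q.commShiftIso n).hom.app Y ≫ (β_ (q.obj X) ((q.obj Y)⟦n⟧)).hom =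
      (β_ (q.obj X) (q.obj (Y⟦n⟧))).hom ≫ (q.commShiftIso n).hom.app Y ▷ q.obj X :=
    BraidedCategory.braiding_naturality_right _ _
  simp only [suspRight, Iso.trans_hom, Functor.mapIso_hom, q.map_comp, Category.assoc, nat]
  rw [Functor.LaxBraided.braided_assoc, reassoc_of% h, reassoc_of% nb]
  simp only [← Functor.map_comp, Functor.LaxBraided.braided]

/-- The analogue of `GEnd.map_tensorL` for a numerator `X⟦n⟧ ⟶ Z`. -/
lemma map_tensorL_hom (A : C) {X Z : C} {n : ℤ} (φ : X⟦n⟧ ⟶ Z) :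
    (q.commShiftIso n).inv.app (A ⊗ X) ≫ q.map ((suspRight A X n).inv ≫ A ◁ φ) =
      (δ q A X)⟦n⟧' ≫ (suspRight (q.obj A) (q.obj X) n).inv ≫
        q.obj A ◁ ((q.commShiftIso n).inv.app X ≫ q.map φ) ≫ μ q A Z := by
  have h := susp_comm_right q A X n
  rw [← cancel_epi ((q.commShiftIso n).hom.app (A ⊗ X)),
    ← cancel_epi (q.map (suspRight A X n).hom), ← cancel_epi (μ q A (X⟦n⟧))]
  trans μ q A (X⟦n⟧) ≫ q.map (A ◁ φ)
  · rw [Iso.hom_inv_id_app_assoc, ← q.map_comp, Iso.hom_inv_id_assoc]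
  · have c₁ : (μ q A X)⟦n⟧' ≫ (δ q A X)⟦n⟧' = 𝟙 _ := by
      rw [← Functor.map_comp, μ_δ, CategoryTheory.Functor.map_id]
    have c₂ : q.obj A ◁ (q.commShiftIso n).hom.app X ≫ q.obj A ◁ (q.commShiftIso n).inv.app X =
        𝟙 _ := by
      rw [← MonoidalCategory.whiskerLeft_comp, Iso.hom_inv_id_app,
        MonoidalCategory.whiskerLeft_id]
    rw [reassoc_of% h, reassoc_of% c₁, Iso.hom_inv_id_assoc, MonoidalCategory.whiskerLeft_comp,
      Category.assoc, reassoc_of% c₂, μ_natural_right]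

variable {Φ : TensorSet C} {S : Submonoid (⨁ i, R Φ i)}

lemma isIso_map_of_mem (hq : q.IsLocalization (thickTensorIdeal (conesOf (S : Set (⨁ i, R Φ i)))).trW)
    {A : C} (hA : Φ.carrier A) {i : ℤ} {s : GEnd A i} (hs : s.Balanced)
    (hS : DirectSum.of (R Φ) i (R.mk A hA s hs) ∈ S) : IsIso (q.map s) := by
  obtain ⟨c, a, b, hT⟩ := distinguished_cocone_triangle s
  exact Localization.inverts q
    (thickTensorIdeal (conesOf (S : Set (⨁ i, R Φ i)))).trW s
    ⟨c, a, b, hT, le_thickTensorIdeal _ _ ⟨i, A, hA, s, hs, a, b, hS, hT⟩⟩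

/-- The quotient functor is faithful up to multiplication by elements of `S`. -/
lemma exists_mul_tensorL_eq_zero
    (hq : q.IsLocalization (thickTensorIdeal (conesOf (S : Set (⨁ i, R Φ i)))).trW)
    {X : C} {j : ℤ} (f : GEnd X j) (hf : q.map f = 0) :
    ∃ (i : ℤ) (A : C) (hA : Φ.carrier A) (s : GEnd A i) (hs : s.Balanced),
      DirectSum.of (R Φ) i (R.mk A hA s hs) ∈ S ∧
        (s.tensorR X).mul (GEnd.tensorL A f) rfl = 0 := by
  have hJ := isThickTensorIdeal_thickTensorIdeal (conesOf (S : Set (⨁ i, R Φ i)))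
  have := hJ.triangulated
  obtain ⟨Z, w, hw, e⟩ := (MorphismProperty.map_eq_iff_postcomp q
    (thickTensorIdeal (conesOf (S : Set (⨁ i, R Φ i)))).trW f 0).1 (by rw [hf, q.map_zero])
  rw [zero_comp] at e
  -- The rotated form of the triangle on `w` is needed: since `f ≫ w = 0`, the map `f` factors
  -- through the fibre of `w`, which lies in the ideal and so is killed by an element of `S`.
  rw [ObjectProperty.trW_iff'] at hw
  obtain ⟨c, b, d, hT, hc⟩ := hw
  obtain ⟨a, ha⟩ := coyoneda_exact₂ hT f e
  obtain ⟨i, A, hA, s, hs, hS, h0⟩ := thickTensorIdeal_conesOf_le_killed S _ hc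
  exact ⟨i, A, hA, s, hs, hS, GEnd.mul_tensorL_of_eq_zero s f rfl a b ha h0⟩

/-- The quotient functor is full up to multiplication by elements of `S`. -/
lemma exists_map_eq_mul
    (hq : q.IsLocalization (thickTensorIdeal (conesOf (S : Set (⨁ i, R Φ i)))).trW)
    {X : C} {n : ℤ} (g : GEnd (q.obj X) n) :
    ∃ (i : ℤ) (A : C) (hA : Φ.carrier A) (s : GEnd A i) (hs : s.Balanced) (h : GEnd (A ⊗ X) (i + n)),
      DirectSum.of (R Φ) i (R.mk A hA s hs) ∈ S ∧
        GEnd.map q h = GEnd.conj (μIso q A X)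
          (((GEnd.map q s).tensorR (q.obj X)).mul (GEnd.tensorL (q.obj A) g) rfl) := by
  have hJ := isThickTensorIdeal_thickTensorIdeal (conesOf (S : Set (⨁ i, R Φ i)))
  have := hJ.triangulated
  -- The morphism `g` is written as a roof with numerator `φ : X⟦n⟧ ⟶ Z` and denominator `w : X ⟶
  -- Z`.
  obtain ⟨@⟨Z, φ, w, hw⟩, e⟩ := Localization.exists_leftFraction q
    (thickTensorIdeal (conesOf (S : Set (⨁ i, R Φ i)))).trW ((q.commShiftIso n).hom.app X ≫ g)
  have hinv := Localization.inverts q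
    (thickTensorIdeal (conesOf (S : Set (⨁ i, R Φ i)))).trW w hw
  have e' : g ≫ q.map w = (q.commShiftIso n).inv.app X ≫ q.map φ := by
    have e₁ := MorphismProperty.LeftFraction.map_comp_map_s
      (W := (thickTensorIdeal (conesOf (S : Set (⨁ i, R Φ i)))).trW) ⟨φ, w, hw⟩ q
      (Localization.inverts q _)
    rw [← e] at e₁
    dsimp at e₁
    rw [← e₁]
    simp
  obtain ⟨c, a, b, hT, hc⟩ := hw
  obtain ⟨i, A, hA, s, hs, hS, h0⟩ := thickTensorIdeal_conesOf_le_killed S _ hc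
  -- As `s` kills the cone of `w`, the map `s ▷ Z` lifts along `A ◁ w`. The lift `u` plays the role
  -- of `s` times the inverse of `w`, so `φ` followed by `u` is a model in `C` for the product of
  -- `s` and `g`.
  obtain ⟨u, hu⟩ : ∃ u, s ▷ Z = u ≫ A ◁ w := by
    obtain ⟨u, hu⟩ := coyoneda_exact₂ (IsThickTensorIdeal.tensorRight_triangle hT A)
      (s ▷ Z ≫ (β_ A Z).hom) (by
        rw [Category.assoc, ← BraidedCategory.braiding_naturality_right,
          ← whisker_exchange_assoc, h0]
        simp)
    refine ⟨u ≫ (β_ X A).hom, ?_⟩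
    rw [← cancel_mono (β_ A Z).hom, hu]
    simp
  let h : GEnd (A ⊗ X) (i + n) := (shiftFunctorAdd' C n i (i + n) (add_comm _ _)).hom.app (A ⊗ X) ≫
    ((suspRight A X n).inv)⟦i⟧' ≫ (suspLeft A (X⟦n⟧) i).inv ≫ A⟦i⟧ ◁ φ ≫ u
  refine ⟨i, A, hA, s, hs, h, hS, ?_⟩
  have hh : h ≫ A ◁ w = (shiftFunctorAdd' C n i (i + n) (add_comm _ _)).hom.app (A ⊗ X) ≫
      ((suspRight A X n).inv ≫ A ◁ φ)⟦i⟧' ≫ s.tensorR Z := by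
    have h₁ : (A ◁ φ)⟦i⟧' ≫ (suspLeft A Z i).inv = (suspLeft A (X⟦n⟧) i).inv ≫ A⟦i⟧ ◁ φ := by
      rw [← cancel_epi (suspLeft A (X⟦n⟧) i).hom, ← cancel_mono (suspLeft A Z i).hom]
      simp [TensorTriangulated.susp_natural A φ i]
    simp only [h, GEnd.tensorR, Category.assoc, ← hu, Functor.map_comp, reassoc_of% h₁]
  have : IsIso (q.map (A ◁ w)) := by
    rw [Functor.Monoidal.map_whiskerLeft]
    infer_instance
  -- The comparison is made after composing with the isomorphism `q.map (A ◁ w)`: this turns `u`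
  -- back into `s ▷ Z` and `g` into `φ`, so that only images of morphisms of `C` remain.
  rw [← cancel_mono (q.map (A ◁ w))]
  have hl : GEnd.map q h ≫ q.map (A ◁ w) =
      (shiftFunctorAdd' D n i (i + n) (add_comm _ _)).hom.app (q.obj (A ⊗ X)) ≫
        ((δ q A X)⟦n⟧' ≫ (suspRight (q.obj A) (q.obj X) n).inv ≫
        q.obj A ◁ ((q.commShiftIso n).inv.app X ≫ q.map φ))⟦i⟧' ≫
          (GEnd.map q s).tensorR (q.obj Z) ≫ μ q A Z := by
    rw [GEnd.map, Category.assoc, ← q.map_comp, hh, map_gradedComp, map_tensorL_hom]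
    have := GEnd.map_tensorR q s Z
    rw [GEnd.map] at this
    rw [this]
    have c₁ : (μ q A Z)⟦i⟧' ≫ (δ q A Z)⟦i⟧' = 𝟙 _ := by
      rw [← Functor.map_comp, μ_δ, CategoryTheory.Functor.map_id]
    simp only [GEnd.conj, Functor.map_comp, Category.assoc, μIso_inv, μIso_hom, reassoc_of% c₁]
  have h₂ : (q.obj A ◁ q.map w)⟦i⟧' ≫ (suspLeft (q.obj A) (q.obj Z) i).inv =
      (suspLeft (q.obj A) (q.obj X) i).inv ≫ (q.obj A)⟦i⟧ ◁ q.map w := by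
    rw [← cancel_epi (suspLeft (q.obj A) (q.obj X) i).hom,
      ← cancel_mono (suspLeft (q.obj A) (q.obj Z) i).hom]
    simp [TensorTriangulated.susp_natural (q.obj A) (q.map w) i]
  have nat := (shiftFunctorAdd' D n i (i + n) (add_comm _ _)).hom.naturality (δ q A X)
  simp only [Functor.comp_map] at nat
  rw [hl, ← e']
  simp only [GEnd.conj, GEnd.mul, GEnd.tensorL, GEnd.tensorR, μIso_inv, μIso_hom, Category.assoc,
    ← μ_natural_right, MonoidalCategory.whiskerLeft_comp, Functor.map_comp, reassoc_of% h₂,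
    whisker_exchange_assoc, reassoc_of% nat]

end

end TTLoc

namespace TTLoc

/-! ### Classes over the quotient as fractions -/

section

variable {C : Type u} [Category.{v} C] [Preadditive C] [HasZeroObject C]
    [HasShift C ℤ] [∀ n : ℤ, (shiftFunctor C n).Additive] [Pretriangulated C] [IsTriangulated C]
    [MonoidalCategory C] [SymmetricCategory C] [MonoidalPreadditive C] [TensorTriangulated C]
    {D : Type u'} [Category.{v'} D] [Preadditive D] [HasZeroObject D]
    [HasShift D ℤ] [∀ n : ℤ, (shiftFunctor D n).Additive] [Pretriangulated D] [IsTriangulated D]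
    [MonoidalCategory D] [SymmetricCategory D] [MonoidalPreadditive D] [TensorTriangulated D]
    (q : C ⥤ D) [q.CommShift ℤ] [q.Braided] [IsTensorTriangulated q]

open Functor.Monoidal

variable {Φ : TensorSet C} {S : Submonoid (⨁ i, R Φ i)}

namespace R

/-- This turns the output of `exists_map_eq_mul` into an identity of classes. The isomorphism `α` is
there because the objects of `Φ.map q` are only isomorphic to images of objects of `Φ`. -/
lemma mk_eq_mk_mul_mk {i j k : ℤ} (h : i + j = k) {A X : C} (hA : (Φ.map q).carrier (q.obj A))
    {s : GEnd (q.obj A) i} (hs : s.Balanced) {f : GEnd (q.obj (A ⊗ X)) k}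
    (hX : (Φ.map q).carrier (q.obj (A ⊗ X))) (hf : f.Balanced) {Y : D}
    (hY : (Φ.map q).carrier Y) {g : GEnd Y j} (hg : g.Balanced) (α : q.obj X ≅ Y)
    (e : f = GEnd.conj (μIso q A X)
      ((s.tensorR (q.obj X)).mul (GEnd.tensorL (q.obj A) (GEnd.conj α.symm g)) h)) :
    mk (q.obj (A ⊗ X)) hX f hf = mul h (mk (q.obj A) hA s hs) (mk Y hY g hg) := by
  rw [mk_mul_mk]
  refine mk_eq _ _ _ _ ((μIso q A X).symm ≪≫ whiskerLeftIso (q.obj A) α) ?_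
  rw [GEnd.conj_trans, GEnd.conj_symm_eq _ _ _ e.symm, GEnd.conj_mul, GEnd.conj_tensorR_right,
    ← GEnd.conj_tensorL_right, ← GEnd.conj_trans, Iso.symm_self_id, GEnd.conj_refl]

/-- Every element of the ring of the quotient is a fraction. -/
lemma exists_mapAdd_eq_mul
    (hq : q.IsLocalization (thickTensorIdeal (conesOf (S : Set (⨁ i, R Φ i)))).trW)
    {n : ℤ} (y : R (Φ.map q) n) :
    ∃ (m k : ℤ) (h : m + n = k) (s : R Φ m) (x : R Φ k), DirectSum.of (R Φ) m s ∈ S ∧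
      mapAdd q Φ k x = mul h (mapAdd q Φ m s) y := by
  induction y using ind with | h Y hY g hg => _
  obtain ⟨X, hX, ⟨α⟩⟩ := id hY
  obtain ⟨j, A, hA, s, hs, f, hsS, hf⟩ := exists_map_eq_mul q hq (GEnd.conj α.symm g)
  have hfb : (GEnd.map q f).Balanced := by
    rw [hf]
    exact (((hs.map q).tensorR _).mul ((hg.conj _).tensorL _) rfl).conj _
  -- The lift `f` of `s g` may fail to be balanced, but its image is balanced, so `q` kills the
  -- defect. Some `t` in `S` then annihilates the defect, and the product of `t` and `f` is
  -- balanced.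
  have h0 : GEnd.map q (f.tensorR (A ⊗ X) - GEnd.tensorL (A ⊗ X) f) = 0 := by
    rw [sub_eq_add_neg, GEnd.map_add, ← GEnd.tensorL_neg, GEnd.map_tensorR, GEnd.map_tensorL,
      ← GEnd.conj_add]
    have : GEnd.map q (-f) = -GEnd.map q f := by simp [GEnd.map]
    rw [this, GEnd.tensorL_neg, hfb, add_neg_cancel, GEnd.conj_zero]
  have h0' : q.map (f.tensorR (A ⊗ X) - GEnd.tensorL (A ⊗ X) f) = 0 := by
    rw [GEnd.map] at h0
    rw [← cancel_epi ((q.commShiftIso _).inv.app _), h0, comp_zero]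
  obtain ⟨i, B, hB, t, ht, htS, hz⟩ := exists_mul_tensorL_eq_zero q hq _ h0'
  have hbal := GEnd.balanced_mul_of_eq ht f rfl (by
    rw [sub_eq_add_neg, GEnd.tensorL_add, GEnd.mul_add, ← GEnd.tensorL_neg] at hz
    have hneg : (t.tensorR ((A ⊗ X) ⊗ A ⊗ X)).mul
        (GEnd.tensorL B (GEnd.tensorL (A ⊗ X) (-f))) rfl =
        -(t.tensorR ((A ⊗ X) ⊗ A ⊗ X)).mul (GEnd.tensorL B (GEnd.tensorL (A ⊗ X) f)) rfl := by
      rw [GEnd.tensorL_neg, GEnd.tensorL_neg]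
      simp [GEnd.mul]
    rw [hneg] at hz
    exact eq_of_sub_eq_zero ((sub_eq_add_neg _ _).trans hz))
  -- The denominator is `t s`: `s` clears the roof, and `t` restores balancedness.
  refine ⟨i + j, i + (j + n), by omega, mul rfl (mk B hB t ht) (mk A hA s hs),
    mk (B ⊗ (A ⊗ X)) (Φ.tensor hB (Φ.tensor hA hX)) _ hbal, ?_, ?_⟩
  · rw [of_mul]
    exact S.mul_mem htS hsS
  · rw [mapAdd_mul, mul_assoc' rfl rfl]
    simp only [mapAdd_mk]
    rw [← mk_eq_mk_mul_mk q rfl (Φ.map_mem q hA) (hs.map q) (Φ.map_mem q (Φ.tensor hA hX)) hfb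
      hY hg α hf]
    refine mk_eq_mk_mul_mk q rfl _ _ _ _ _ _ (Iso.refl _) ?_
    rw [GEnd.map_mul, GEnd.map_tensorR, GEnd.map_tensorL, ← GEnd.conj_mul, Iso.refl_symm,
      GEnd.conj_refl]

/-- The elements of `S` become invertible in the ring of the quotient. -/
lemma exists_inverse_mapAdd
    (hq : q.IsLocalization (thickTensorIdeal (conesOf (S : Set (⨁ i, R Φ i)))).trW)
    {i : ℤ} (s : R Φ i) (hs : DirectSum.of (R Φ) i s ∈ S) :
    ∃ t : R (Φ.map q) (-i), mul (add_neg_cancel i) (mapAdd q Φ i s) t = one ∧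
      mul (neg_add_cancel i) t (mapAdd q Φ i s) = one := by
  induction s using ind with | h A hA s hsb => _
  have := isIso_map_of_mem q hq hA hsb hs
  have : IsIso (GEnd.map q s) := by
    rw [GEnd.map]
    infer_instance
  obtain ⟨t, ht, h₁, h₂⟩ := (hsb.map q).exists_inverse
  refine ⟨mk (q.obj A) (Φ.map_mem q hA) t ht, ?_, ?_⟩
  · rw [mapAdd_mk, mk_mul, mk_congr _ _ h₁, mk_one]
  · rw [mapAdd_mk, mk_mul, mk_congr _ _ h₂, mk_one]

/-- An element that vanishes in the ring of the quotient is annihilated by an element of `S`. -/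
lemma exists_mul_eq_zero
    (hq : q.IsLocalization (thickTensorIdeal (conesOf (S : Set (⨁ i, R Φ i)))).trW)
    {j : ℤ} (x : R Φ j) (hx : mapAdd q Φ j x = 0) :
    ∃ (i : ℤ) (s : R Φ i), DirectSum.of (R Φ) i s ∈ S ∧ mul rfl s x = 0 := by
  induction x using ind with | h X hX f hf => _
  rw [mapAdd_mk, mk_eq_zero_iff] at hx
  obtain ⟨a, ⟨A, hA, ⟨α⟩⟩, h0⟩ := hx
  -- The object that witnesses the vanishing comes from some `A` in `Φ`. Replacing `f` by `f ⊗ A`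
  -- does not change its class and makes its image under `q` zero.
  have h0' : GEnd.map q (f.tensorR A) = 0 := by
    rw [GEnd.map_tensorR, ← GEnd.conj_tensorR_right _ α.symm, h0, GEnd.conj_zero, GEnd.conj_zero]
  rw [GEnd.map] at h0'
  obtain ⟨i, B, hB, t, ht, htS, hz⟩ := exists_mul_tensorL_eq_zero q hq (f.tensorR A)
    (by rw [← cancel_epi ((q.commShiftIso _).inv.app _), h0', comp_zero])
  refine ⟨i, mk B hB t ht, htS, ?_⟩
  rw [← mk_tensorR A X hA hX f hf, mk_mul_mk, mk_congr _ _ hz, mk_zero]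

end R

end

end TTLoc

namespace TTLoc

/-! ### Signs in the graded ring -/

namespace R

variable {C : Type u} [Category.{v} C] [Preadditive C] [HasZeroObject C]
    [HasShift C ℤ] [∀ n : ℤ, (shiftFunctor C n).Additive] [Pretriangulated C] [IsTriangulated C]
    [MonoidalCategory C] [SymmetricCategory C] [MonoidalPreadditive C] [TensorTriangulated C]
    {Φ : TensorSet C}

lemma neg_mul' {i j k : ℤ} (h : i + j = k) (x : R Φ i) (y : R Φ j) :
    mul h (-x) y = -mul h x y := by
  subst h
  exact congrArg (fun f => f y) (map_neg (DirectSum.gMulHom (R Φ)) x)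

lemma smul_mul' {i j k : ℤ} (h : i + j = k) (ε : ℤˣ) (x : R Φ i) (y : R Φ j) :
    mul h (ε • x) y = ε • mul h x y := by
  rcases Int.units_eq_one_or ε with rfl | rfl
  · simp only [one_smul]
  · simp only [Units.neg_smul, one_smul, neg_mul']

lemma mul_left_comm' {i j k l m n : ℤ} (h₁ : j + k = l) (h₂ : i + l = n) (h₃ : i + k = m)
    (x : R Φ i) (y : R Φ j) (z : R Φ k) :
    mul h₂ x (mul h₁ y z) = (i * j).negOnePow • mul (by omega) y (mul h₃ x z) := by
  rw [← mul_assoc' rfl h₁ (by omega), mul_comm' rfl x y, smul_mul', mul_assoc' (by omega) h₃]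

end R

section

variable {C : Type u} [Category.{v} C] [Preadditive C] [HasZeroObject C]
    [HasShift C ℤ] [∀ n : ℤ, (shiftFunctor C n).Additive] [Pretriangulated C] [IsTriangulated C]
    [MonoidalCategory C] [SymmetricCategory C] [MonoidalPreadditive C] [TensorTriangulated C]
    {D : Type u'} [Category.{v'} D] [Preadditive D] [HasZeroObject D]
    [HasShift D ℤ] [∀ n : ℤ, (shiftFunctor D n).Additive] [Pretriangulated D] [IsTriangulated D]
    [MonoidalCategory D] [SymmetricCategory D] [MonoidalPreadditive D] [TensorTriangulated D]
    (q : C ⥤ D) [q.CommShift ℤ] [q.Braided] [IsTensorTriangulated q]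
    {Φ : TensorSet C} {S : Submonoid (⨁ i, R Φ i)}

lemma mapAdd_units_smul {i : ℤ} (ε : ℤˣ) (x : R Φ i) :
    R.mapAdd q Φ i (ε • x) = ε • R.mapAdd q Φ i x := by
  rcases Int.units_eq_one_or ε with rfl | rfl
  · simp only [one_smul]
  · simp only [Units.neg_smul, one_smul, map_neg]

/-! ### The ring isomorphism -/

section Localization

/-- The map is computed degree by degree, so each homogeneous component is killed by some element of
`S`. Only finitely many components are nonzero and `S` is central, so the product of these
annihilators kills them all. -/
lemma exists_mul_eq_zero_of_mapRingHom
    (hS : ∀ s ∈ S, ∃ (i : ℤ) (x : R Φ i), Even i ∧ s = DirectSum.of (R Φ) i x)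
    (hq : q.IsLocalization (thickTensorIdeal (conesOf (S : Set (⨁ i, R Φ i)))).trW)
    (r : ⨁ i, R Φ i) (hr : R.mapRingHom q Φ r = 0) : ∃ s ∈ S, s * r = 0 := by
  classical
  have hcomp : ∀ (r : ⨁ i, R Φ i) (n : ℤ), R.mapRingHom q Φ r n = R.mapAdd q Φ n (r n) := by
    intro r n
    induction r using DirectSum.induction_on with
    | zero => simp
    | of i x =>
      rw [R.mapRingHom_of]
      by_cases h : i = n
      · subst h
        rw [DirectSum.of_eq_same, DirectSum.of_eq_same]
      · rw [DirectSum.of_eq_of_ne _ _ _ (Ne.symm h), DirectSum.of_eq_of_ne _ _ _ (Ne.symm h),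
          map_zero]
    | add x y hx hy => rw [map_add, DirectSum.add_apply, DirectSum.add_apply, hx, hy, map_add]
  have key : ∀ T : Finset ℤ, ∃ s ∈ S, ∀ i ∈ T, s * DirectSum.of (R Φ) i (r i) = 0 := by
    intro T
    induction T using Finset.induction_on with
    | empty => exact ⟨1, S.one_mem, by simp⟩
    | insert a T _ ih =>
      obtain ⟨s, hs, h⟩ := ih
      obtain ⟨i, t, ht, h'⟩ := R.exists_mul_eq_zero q hq (r a) (by rw [← hcomp, hr]; rfl)
      obtain ⟨j, x, hj, rfl⟩ := hS s hs
      refine ⟨_, S.mul_mem ht hs, fun n hn => ?_⟩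
      rcases Finset.mem_insert.1 hn with rfl | hn
      · rw [← (R.central_of_even hj x _).eq, mul_assoc, ← R.of_mul rfl, h', map_zero,
          MulZeroClass.mul_zero]
      · rw [mul_assoc, h n hn, MulZeroClass.mul_zero]
  obtain ⟨s, hs, h⟩ := key (DFinsupp.support r)
  refine ⟨s, hs, ?_⟩
  rw [← DirectSum.sum_support_of r, Finset.mul_sum]
  exact Finset.sum_eq_zero h

/-- The universal property gives the map. It is injective because elements with zero image are
killed by `S`, and surjective because homogeneous elements are fractions. -/
lemma exists_localization_ringEquiv (S : Submonoid (⨁ i, R Φ i))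
    (hS : ∀ s ∈ S, ∃ (i : ℤ) (x : R Φ i), Even i ∧ s = DirectSum.of (R Φ) i x)
    (hq : q.IsLocalization (thickTensorIdeal (conesOf (S : Set (⨁ i, R Φ i)))).trW) :
    letI : OreLocalization.OreSet S := oreSet S hS
    ∃ e : OreLocalization S (⨁ i, R Φ i) ≃+* ⨁ i, R (Φ.map q) i,
      (∀ r : ⨁ i, R Φ i, e (OreLocalization.oreDiv r 1) = R.mapRingHom q Φ r) ∧
      ∀ (n : ℤ) (z : OreLocalization S (⨁ i, R Φ i)),
        (∃ y : R (Φ.map q) n, e z = DirectSum.of (R (Φ.map q)) n y) ↔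
          ∃ (i j : ℤ) (x : R Φ i) (s : R Φ j) (hs : DirectSum.of (R Φ) j s ∈ S),
            i - j = n ∧ z = OreLocalization.oreDiv (DirectSum.of (R Φ) i x)
              (⟨DirectSum.of (R Φ) j s, hs⟩ : S) := by
  let : OreLocalization.OreSet S := oreSet S hS
  let f := R.mapRingHom q Φ
  have hinv : ∀ {i : ℤ} (x : R Φ i), DirectSum.of (R Φ) i x ∈ S →
      ∃ t : R (Φ.map q) (-i), f (DirectSum.of (R Φ) i x) * DirectSum.of _ (-i) t = 1 ∧
        DirectSum.of _ (-i) t * f (DirectSum.of (R Φ) i x) = 1 := by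
    intro i x hx
    obtain ⟨t, h₁, h₂⟩ := R.exists_inverse_mapAdd q hq x hx
    refine ⟨t, ?_, ?_⟩
    · rw [R.mapRingHom_of, ← R.of_mul (add_neg_cancel i), h₁]
      rfl
    · rw [R.mapRingHom_of, ← R.of_mul (neg_add_cancel i), h₂]
      rfl
  have hunit : ∀ s : S, IsUnit
      ((f : (⨁ i, R Φ i) →* ⨁ i, R (Φ.map q) i).comp S.subtype s) := by
    rintro ⟨s, hs⟩
    obtain ⟨i, x, -, rfl⟩ := hS s hs
    obtain ⟨t, h₁, h₂⟩ := hinv x hs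
    exact ⟨⟨_, _, h₁, h₂⟩, rfl⟩
  let fS : S →* (⨁ i, R (Φ.map q) i)ˣ := IsUnit.liftRight _ hunit
  have hfS : ∀ s : S, f s = fS s := fun s => (IsUnit.coe_liftRight _ hunit s).symm
  let φ := OreLocalization.universalHom f fS hfS
  -- The value at `r / s` is the unique solution `y` of `f s * y = f r`; all values are computed
  -- through this equation.
  have hφ : ∀ (r : ⨁ i, R Φ i) (s : S), f s * φ (OreLocalization.oreDiv r s) = f r := by
    intro r s
    rw [OreLocalization.universalHom_apply, hfS, Units.mul_inv_cancel_left]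
  have hφ' : ∀ (r : ⨁ i, R Φ i) (s : S) (y : ⨁ i, R (Φ.map q) i), f s * y = f r →
      φ (OreLocalization.oreDiv r s) = y := by
    intro r s y h
    rw [← hφ r s, hfS, Units.mul_right_inj] at h
    exact h.symm
  have hinj : Function.Injective φ := by
    rw [injective_iff_map_eq_zero]
    intro z hz
    induction z using OreLocalization.ind with | _ r s => _
    have hr : f r = 0 := by rw [← hφ r s, hz, MulZeroClass.mul_zero]
    obtain ⟨t, ht, h0⟩ := exists_mul_eq_zero_of_mapRingHom q hS hq r hr
    rw [OreLocalization.expand r s t (S.mul_mem ht s.2), smul_eq_mul, h0,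
      OreLocalization.zero_oreDiv]
  have hhom : ∀ {n : ℤ} (y : R (Φ.map q) n), ∃ (i j : ℤ) (x : R Φ i) (s : R Φ j)
      (hs : DirectSum.of (R Φ) j s ∈ S), i - j = n ∧
        φ (OreLocalization.oreDiv (DirectSum.of (R Φ) i x)
              (⟨DirectSum.of (R Φ) j s, hs⟩ : S)) = DirectSum.of _ n y := by
    intro n y
    obtain ⟨m, k, h, s, x, hs, e⟩ := R.exists_mapAdd_eq_mul q hq y
    refine ⟨k, m, x, s, hs, by omega, hφ' _ _ _ ?_⟩
    rw [R.mapRingHom_of, R.mapRingHom_of, e, R.of_mul]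
  have hsurj : Function.Surjective φ := by
    intro y
    induction y using DirectSum.induction_on with
    | zero => exact ⟨0, map_zero φ⟩
    | of n y =>
      obtain ⟨i, j, x, s, hs, -, h⟩ := hhom y
      exact ⟨_, h⟩
    | add y y' hy hy' =>
      obtain ⟨z, rfl⟩ := hy
      obtain ⟨z', rfl⟩ := hy'
      exact ⟨z + z', map_add φ z z'⟩
  refine ⟨RingEquiv.ofBijective φ ⟨hinj, hsurj⟩, fun r => ?_, fun n z => ⟨?_, ?_⟩⟩
  · refine hφ' r 1 _ ?_
    rw [Submonoid.coe_one, map_one, _root_.one_mul]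
  · rintro ⟨y, hy⟩
    obtain ⟨i, j, x, s, hs, hij, h⟩ := hhom y
    exact ⟨i, j, x, s, hs, hij, hinj (hy.trans h.symm)⟩
  · rintro ⟨i, j, x, s, hs, rfl, rfl⟩
    obtain ⟨t, h₁, h₂⟩ := hinv s hs
    -- The inverse `t` of the image of `s` has degree `-j`, so the solution `t` times the image of
    -- `x` is homogeneous of degree `i - j`.
    refine ⟨R.mul (show -j + i = i - j by omega) t (R.mapAdd q Φ i x), hφ' _ _ _ ?_⟩
    rw [R.of_mul, ← mul_assoc, h₁, _root_.one_mul, R.mapRingHom_of]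

end Localization

/-! ### Homogeneous primes of the localization -/

section HomogeneousSpectrum

lemma Spech.ext_carrier {A : ℤ → Type*} [∀ i, AddCommGroup (A i)] [DirectSum.GRing A]
    {p p' : Spech A} (h : ∀ i x, x ∈ p.carrier i ↔ x ∈ p'.carrier i) : p = p' := by
  obtain ⟨c, _, _, _, _⟩ := p
  obtain ⟨c', _, _, _, _⟩ := p'
  obtain rfl : c = c' := funext fun i => AddSubgroup.ext (h i)
  rfl

lemma Spech.mul_mem {p : Spech (R Φ)} {i j k : ℤ} (h : i + j = k) (x : R Φ i) {y : R Φ j}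
    (hy : y ∈ p.carrier j) : R.mul h x y ∈ p.carrier k := by
  subst h
  exact p.mul_mem_left x hy

lemma Spech.mul_mem_iff (p : Spech (R Φ)) {i j k : ℤ} (h : i + j = k) (x : R Φ i) (y : R Φ j) :
    R.mul h x y ∈ p.carrier k ↔ x ∈ p.carrier i ∨ y ∈ p.carrier j := by
  subst h
  exact ⟨p.mem_or_mem, fun h => h.elim (p.mul_mem_right y) (p.mul_mem_left x)⟩

/-- `y = x / s` in the ring of the quotient, with `s ∈ S`. -/
def R.IsFraction (S : Submonoid (⨁ i, R Φ i)) {m n k : ℤ} (h : m + n = k) (s : R Φ m)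
    (x : R Φ k) (y : R (Φ.map q) n) : Prop :=
  DirectSum.of (R Φ) m s ∈ S ∧ R.mapAdd q Φ k x = R.mul h (R.mapAdd q Φ m s) y

namespace R.IsFraction

variable {q}

lemma of_mapAdd {n : ℤ} (x : R Φ n) :
    IsFraction q S (zero_add n) R.one x (R.mapAdd q Φ n x) :=
  ⟨S.one_mem, by rw [R.mapAdd_one, R.one_mul']⟩

/-- The common denominator is `s s'`; the sign comes from moving `s'` past `s`. -/
lemma add {m n k m' k' : ℤ} {h : m + n = k} {h' : m' + n = k'} {s : R Φ m} {x : R Φ k}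
    {s' : R Φ m'} {x' : R Φ k'} {y y' : R (Φ.map q) n} (H : IsFraction q S h s x y)
    (H' : IsFraction q S h' s' x' y') :
    IsFraction q S (show m + m' + n = m + k' by omega) (R.mul rfl s s')
      ((m' * m).negOnePow • R.mul (by omega) s' x + R.mul rfl s x') (y + y') := by
  refine ⟨by rw [R.of_mul]; exact S.mul_mem H.1 H'.1, ?_⟩
  rw [map_add, mapAdd_units_smul, R.mapAdd_mul, R.mapAdd_mul, H.2, H'.2,
    R.mul_left_comm' _ _ h', smul_smul, Int.units_mul_self, one_smul, ← R.mul_add',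
    ← R.mul_add', R.mapAdd_mul, R.mul_assoc' rfl h']

lemma neg {m n k : ℤ} {h : m + n = k} {s : R Φ m} {x : R Φ k} {y : R (Φ.map q) n}
    (H : IsFraction q S h s x y) : IsFraction q S h s (-x) (-y) :=
  ⟨H.1, by rw [map_neg, R.mul_neg', H.2]⟩

/-- The sign comes from moving `y` past `s'` in `(s y) (s' y')`. -/
lemma mul {m n k m' n' k' l : ℤ} {h : m + n = k} {h' : m' + n' = k'} {s : R Φ m} {x : R Φ k}
    {s' : R Φ m'} {x' : R Φ k'} {y : R (Φ.map q) n} {y' : R (Φ.map q) n'} (hl : n + n' = l)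
    (H : IsFraction q S h s x y) (H' : IsFraction q S h' s' x' y') :
    IsFraction q S (show m + m' + l = k + k' by omega) (R.mul rfl s s')
      ((n * m').negOnePow • R.mul rfl x x') (R.mul hl y y') := by
  refine ⟨by rw [R.of_mul]; exact S.mul_mem H.1 H'.1, ?_⟩
  rw [mapAdd_units_smul, R.mapAdd_mul, H.2, H'.2, R.mul_assoc' h rfl,
    R.mul_left_comm' h' rfl hl, R.mul_smul', smul_smul, Int.units_mul_self, one_smul,
    R.mapAdd_mul, R.mul_assoc' rfl]

/-- The numerators of two fractions that agree belong to the same primes that avoid `S`. -/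
lemma mem_of_mem
    (hq : q.IsLocalization (thickTensorIdeal (conesOf (S : Set (⨁ i, R Φ i)))).trW)
    {p : Spech (R Φ)} (hp : p.Avoids (S : Set (⨁ i, R Φ i)))
    {m n k m' k' : ℤ} {h : m + n = k} {h' : m' + n = k'} {s : R Φ m} {x : R Φ k}
    {s' : R Φ m'} {x' : R Φ k'} {y : R (Φ.map q) n} (H : IsFraction q S h s x y)
    (H' : IsFraction q S h' s' x' y) (hx : x ∈ p.carrier k) : x' ∈ p.carrier k' := by
  -- The difference of the two fractions is zero, so its numerator is killed by an element of `S`.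
  -- As the prime avoids `S`, it contains this numerator, then `s x'`, and finally `x'`.
  obtain ⟨-, e⟩ := H.neg.add H'
  rw [neg_add_cancel, R.mul_zero'] at e
  obtain ⟨i, t, ht, h0⟩ := R.exists_mul_eq_zero q hq _ e
  have h2 := ((p.mul_mem_iff _ _ _).1 (h0 ▸ zero_mem (p.carrier _))).resolve_left (hp _ _ ht)
  rw [AddSubgroup.add_mem_cancel_left] at h2
  · exact ((p.mul_mem_iff _ _ _).1 h2).resolve_left (hp _ _ H.1)
  · rw [units_smul_mem_iff]
    exact Spech.mul_mem _ _ (neg_mem hx)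

end R.IsFraction

lemma R.exists_isFraction
    (hq : q.IsLocalization (thickTensorIdeal (conesOf (S : Set (⨁ i, R Φ i)))).trW)
    {n : ℤ} (y : R (Φ.map q) n) : ∃ (m k : ℤ) (h : m + n = k) (s : R Φ m) (x : R Φ k),
      R.IsFraction q S h s x y :=
  R.exists_mapAdd_eq_mul q hq y

/-- The extension to the quotient of a homogeneous prime that avoids `S`. -/
def Spech.extend
    (hq : q.IsLocalization (thickTensorIdeal (conesOf (S : Set (⨁ i, R Φ i)))).trW)
    (p : Spech (R Φ)) (hp : p.Avoids (S : Set (⨁ i, R Φ i))) : Spech (R (Φ.map q)) where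
  carrier n :=
    { carrier := {y | ∃ (m k : ℤ) (h : m + n = k) (s : R Φ m) (x : R Φ k),
        R.IsFraction q S h s x y ∧ x ∈ p.carrier k}
      zero_mem' := ⟨0, n, _, _, 0, by
        simpa using R.IsFraction.of_mapAdd (q := q) (S := S) (0 : R Φ n), zero_mem _⟩
      add_mem' := by
        rintro y y' ⟨m, k, h, s, x, H, hx⟩ ⟨m', k', h', s', x', H', hx'⟩
        exact ⟨_, _, _, _, _, H.add H', add_mem
          ((units_smul_mem_iff _ _ _).2 (Spech.mul_mem _ _ hx)) (Spech.mul_mem _ _ hx')⟩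
      neg_mem' := by
        rintro y ⟨m, k, h, s, x, H, hx⟩
        exact ⟨_, _, _, _, _, H.neg, neg_mem hx⟩ }
  mul_mem_left {_ _} y {y'} := by
    rintro ⟨m', k', h', s', x', H', hx'⟩
    obtain ⟨m, k, h, s, x, H⟩ := R.exists_isFraction q hq y
    exact ⟨_, _, _, _, _, H.mul rfl H', (units_smul_mem_iff _ _ _).2 (Spech.mul_mem _ _ hx')⟩
  mul_mem_right {_ _ y} y' := by
    rintro ⟨m, k, h, s, x, H, hx⟩
    obtain ⟨m', k', h', s', x', H'⟩ := R.exists_isFraction q hq y'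
    exact ⟨_, _, _, _, _, H.mul rfl H', (units_smul_mem_iff _ _ _).2
      ((p.mul_mem_iff _ _ _).2 (Or.inl hx))⟩
  one_notMem := by
    rintro ⟨m, k, h, s, x, H, hx⟩
    have H' : R.IsFraction q S (zero_add 0) R.one R.one (R.one : R (Φ.map q) 0) := by
      have := R.IsFraction.of_mapAdd (q := q) (S := S) (R.one : R Φ 0)
      rwa [R.mapAdd_one] at this
    exact p.one_notMem (H.mem_of_mem hq hp H' hx)
  mem_or_mem {_ _ y y'} := by
    rintro ⟨m'', k'', h'', s'', x'', H'', hx''⟩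
    obtain ⟨m, k, h, s, x, H⟩ := R.exists_isFraction q hq y
    obtain ⟨m', k', h', s', x', H'⟩ := R.exists_isFraction q hq y'
    -- Membership does not depend on the fraction chosen, so the given one may be replaced by the
    -- product of fractions for the two factors.
    have := H''.mem_of_mem hq hp (H.mul rfl H') hx''
    rw [units_smul_mem_iff, p.mul_mem_iff] at this
    exact this.imp (fun hx => ⟨_, _, _, _, _, H, hx⟩) (fun hx => ⟨_, _, _, _, _, H', hx⟩)

/-- Elements of `S` become units, and a prime contains no unit. -/
lemma Spech.mapAdd_notMem
    (hq : q.IsLocalization (thickTensorIdeal (conesOf (S : Set (⨁ i, R Φ i)))).trW)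
    (p : Spech (R (Φ.map q))) {i : ℤ} (s : R Φ i) (hs : DirectSum.of (R Φ) i s ∈ S) :
    R.mapAdd q Φ i s ∉ p.carrier i := by
  intro h
  obtain ⟨t, -, ht⟩ := R.exists_inverse_mapAdd q hq s hs
  have := Spech.mul_mem (neg_add_cancel i) t h
  rw [ht] at this
  exact p.one_notMem this

/-- The denominator lies outside the prime, so only the numerator matters. Hence a prime of the
quotient ring is determined by its contraction, and basic open sets upstairs are inverse images of
basic open sets. -/
lemma Spech.mem_iff_of_isFraction
    (hq : q.IsLocalization (thickTensorIdeal (conesOf (S : Set (⨁ i, R Φ i)))).trW)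
    (p : Spech (R (Φ.map q))) {m n k : ℤ} {h : m + n = k} {s : R Φ m} {x : R Φ k}
    {y : R (Φ.map q) n} (H : R.IsFraction q S h s x y) :
    y ∈ p.carrier n ↔ x ∈ (Spech.comapR q Φ p).carrier k := by
  change _ ↔ R.mapAdd q Φ k x ∈ p.carrier k
  rw [H.2, p.mul_mem_iff, or_iff_right (p.mapAdd_notMem q hq s H.1)]

lemma Spech.isEmbedding_comapR
    (hq : q.IsLocalization (thickTensorIdeal (conesOf (S : Set (⨁ i, R Φ i)))).trW) :
    Topology.IsEmbedding (Spech.comapR q Φ) := by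
  refine ⟨⟨?_⟩, fun p p' h => Spech.ext_carrier fun n y => ?_⟩
  · refine le_antisymm ?_ ?_
    · rw [← continuous_iff_le_induced, continuous_generateFrom_iff]
      rintro _ ⟨i, x, rfl⟩
      exact TopologicalSpace.isOpen_generateFrom_of_mem ⟨i, R.mapAdd q Φ i x, rfl⟩
    · refine le_generateFrom ?_
      rintro _ ⟨n, y, rfl⟩
      obtain ⟨m, k, h, s, x, H⟩ := R.exists_isFraction q hq y
      refine ⟨{p | x ∉ p.carrier k}, TopologicalSpace.isOpen_generateFrom_of_mem ⟨k, x, rfl⟩, ?_⟩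
      ext p
      exact not_congr (p.mem_iff_of_isFraction q hq H).symm
  · obtain ⟨m, k, e, s, x, H⟩ := R.exists_isFraction q hq y
    rw [p.mem_iff_of_isFraction q hq H, p'.mem_iff_of_isFraction q hq H, h]

/-- Contracting `Spech.extend` gives back the original prime: `x` is the numerator of `x / 1`, and
membership does not depend on the fraction. -/
lemma Spech.range_comapR
    (hq : q.IsLocalization (thickTensorIdeal (conesOf (S : Set (⨁ i, R Φ i)))).trW) :
    Set.range (Spech.comapR q Φ) = {p | p.Avoids (S : Set (⨁ i, R Φ i))} := by
  ext p
  constructor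
  · rintro ⟨p, rfl⟩ i s hs
    exact p.mapAdd_notMem q hq s hs
  · intro hp
    refine ⟨p.extend q hq hp, Spech.ext_carrier fun i x => ⟨?_, fun hx => ?_⟩⟩
    · rintro ⟨m, k, h, s, x', H, hx'⟩
      exact H.mem_of_mem hq hp (R.IsFraction.of_mapAdd x) hx'
    · exact ⟨_, _, _, _, _, R.IsFraction.of_mapAdd x, hx⟩

end HomogeneousSpectrum

/-! ### The comparison maps and triangular primes -/

section Spectrum

/-- The basic open set of `[f]` pulls back to the complement of the support of the cone of `f`. -/
lemma continuous_rho (Φ : TensorSet C) : Continuous (rho Φ) := by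
  rw [continuous_generateFrom_iff]
  rintro _ ⟨i, x, rfl⟩
  induction x using R.ind with | h X hX f hf => _
  obtain ⟨c, a, b, hT⟩ := distinguished_cocone_triangle f
  refine ⟨(Spc.supp c)ᶜ, TopologicalSpace.isOpen_generateFrom_of_mem ⟨c, rfl⟩, ?_⟩
  ext P
  exact not_congr (mem_rho P hX hf hT).symm

/-- An exact functor sends a cone of `f` to a cone of the image of `f`. -/
lemma rho_comap (Q : Z (Φ.map q)) :
    rho Φ (Z.comap q Φ Q) = Spech.comapR q Φ (rho (Φ.map q) Q) := by
  refine Spech.ext_carrier fun i x => ?_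
  induction x using R.ind with | h X hX f hf => _
  refine not_congr ?_
  change (Q.1.carrier.inverseImage q).trW f ↔ Q.1.carrier.trW (GEnd.map q f)
  have := Q.1.thick.retracts
  rw [ObjectProperty.inverseImage_trW_iff, GEnd.map,
    Q.1.carrier.trW.cancel_left_of_respectsIso]

lemma Spc.ext_carrier {P P' : Spc C} (h : ∀ X, P.carrier X ↔ P'.carrier X) : P = P' := by
  obtain ⟨c, _, _, _⟩ := P
  obtain ⟨c', _, _, _⟩ := P'
  obtain rfl : c = c' := funext fun X => propext (h X)
  rfl

lemma Spc.prop_iff_of_iso (P : Spc C) {X Y : C} (e : X ≅ Y) : P.carrier X ↔ P.carrier Y := by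
  have := P.thick.retracts
  exact P.carrier.prop_iff_of_iso e

/-- Each object of the target is isomorphic to some `q X`, so primes are determined by their inverse
images and supports are pulled back from supports. -/
lemma Spc.isEmbedding_comap [q.EssSurj] : Topology.IsEmbedding (Spc.comap q) := by
  have key : ∀ (Q : Spc D) (Y : D), Q.carrier Y ↔ (Spc.comap q Q).carrier (q.objPreimage Y) :=
    fun Q Y => Q.prop_iff_of_iso (q.objObjPreimageIso Y).symm
  refine ⟨⟨le_antisymm ?_ ?_⟩, fun Q Q' h => Spc.ext_carrier fun Y => ?_⟩
  · rw [← continuous_iff_le_induced, continuous_generateFrom_iff]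
    rintro _ ⟨X, rfl⟩
    exact TopologicalSpace.isOpen_generateFrom_of_mem ⟨q.obj X, rfl⟩
  · refine le_generateFrom ?_
    rintro _ ⟨Y, rfl⟩
    refine ⟨(Spc.supp (q.objPreimage Y))ᶜ,
      TopologicalSpace.isOpen_generateFrom_of_mem ⟨_, rfl⟩, ?_⟩
    ext Q
    exact not_congr (not_congr (key Q Y).symm)
  · rw [key, key, h]

/-- A prime that contains `J` descends to the quotient as a property of objects; the ideal and
primality conditions are checked on preimages, as `q` is essentially surjective and monoidal. -/
lemma Spc.exists_comap_eq (J : ObjectProperty C) [J.IsTriangulated] [q.IsLocalization J.trW]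
    (P : Spc C) (hJ : J ≤ P.carrier) : ∃ Q : Spc D, Spc.comap q Q = P := by
  have := P.thick.triangulated
  have := P.thick.retracts
  have := Localization.essSurj q J.trW
  obtain ⟨Q, hr, hQ⟩ := exists_inverseImage_eq q J P.carrier hJ
  have hQ' : ∀ Y, Q Y ↔ P.carrier (q.objPreimage Y) := fun Y => by
    rw [← hQ, Q.prop_iff_of_iso (q.objObjPreimageIso Y)]
  have hQt : ∀ Y Y', Q (Y ⊗ Y') ↔ P.carrier (q.objPreimage Y ⊗ q.objPreimage Y') := fun Y Y' => by
    rw [← hQ, Q.prop_iff_of_iso ((Functor.Monoidal.μIso q _ _).symm ≪≫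
      (q.objObjPreimageIso Y ⊗ᵢ q.objObjPreimageIso Y'))]
  refine ⟨⟨Q, ⟨isTriangulated_of_inverseImage q J.trW P.carrier Q hQ, hr, fun X Y h => ?_⟩,
    ?_, fun {Y Y'} h => ?_⟩, Spc.ext_carrier hQ⟩
  · rw [hQt]
    exact P.thick.tensor _ ((hQ' Y).1 h)
  · obtain ⟨X, hX⟩ := P.proper
    exact ⟨q.obj X, fun h => hX ((hQ X).1 h)⟩
  · rw [hQ', hQ']
    exact P.prime ((hQt Y Y').1 h)

lemma Z.isEmbedding_comap [q.EssSurj] : Topology.IsEmbedding (Z.comap q Φ) :=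
  Topology.IsEmbedding.of_comp
    (Continuous.subtype_mk ((Spc.isEmbedding_comap q).continuous.comp continuous_subtype_val) _)
    continuous_subtype_val
    ((Spc.isEmbedding_comap q).comp Topology.IsEmbedding.subtypeVal)

/-- Avoiding `S` means containing the cones of all representatives of its elements, and hence the
thick `⊗`-ideal that they generate. The other inclusion follows from commutativity of the square. -/
lemma Z.range_comap
    (hq : q.IsLocalization (thickTensorIdeal (conesOf (S : Set (⨁ i, R Φ i)))).trW) :
    Set.range (Z.comap q Φ) = {P | (rho Φ P).Avoids (S : Set (⨁ i, R Φ i))} := by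
  have := (isThickTensorIdeal_thickTensorIdeal (conesOf (S : Set (⨁ i, R Φ i)))).triangulated
  ext P
  constructor
  · rintro ⟨Q, rfl⟩
    rw [Set.mem_ofPred_eq, rho_comap]
    exact (Spech.range_comapR q hq).subset ⟨_, rfl⟩
  · intro hP
    obtain ⟨Q, hQ⟩ := Spc.exists_comap_eq q _ P.1
      (thickTensorIdeal_le (E := conesOf (S : Set (⨁ i, R Φ i))) P.1.thick (by
        rintro c ⟨i, X, hX, f, hf, a, b, hS, hT⟩
        have := hP i _ hS
        rwa [mem_rho P hX hf hT, not_not] at this))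
    refine ⟨⟨Q, Set.mem_iInter₂.2 ?_⟩, Subtype.ext hQ⟩
    rintro Y ⟨X, hX, ⟨α⟩⟩ hY
    refine Z.notMem P hX ?_
    rw [← hQ]
    exact (Q.prop_iff_of_iso α).2 hY

end Spectrum

end

end TTLoc

theorem mainTheorem6
    {C : Type u} [Category.{v} C] [Preadditive C] [HasZeroObject C] [HasShift C ℤ]
    [∀ n : ℤ, (shiftFunctor C n).Additive] [Pretriangulated C] [IsTriangulated C]
    [MonoidalCategory C] [SymmetricCategory C] [MonoidalPreadditive C] [TensorTriangulated C]
    {D : Type u'} [Category.{v'} D] [Preadditive D] [HasZeroObject D] [HasShift D ℤ]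
    [∀ n : ℤ, (shiftFunctor D n).Additive] [Pretriangulated D] [IsTriangulated D]
    [MonoidalCategory D] [SymmetricCategory D] [MonoidalPreadditive D] [TensorTriangulated D]
    (Φ : TensorSet C) (S : Submonoid (⨁ i, R Φ i))
    (hS : ∀ s ∈ S, ∃ (i : ℤ) (x : R Φ i), Even i ∧ s = DirectSum.of (R Φ) i x)
    (q : C ⥤ D) [q.CommShift ℤ] [q.Braided] [IsTensorTriangulated q]
    (hq : q.IsLocalization (thickTensorIdeal (conesOf (S : Set (⨁ i, R Φ i)))).trW) :
    letI : OreLocalization.OreSet S := oreSet S hS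
    -- the localization of the graded ring
    (∃ e : OreLocalization S (⨁ i, R Φ i) ≃+* ⨁ i, R (Φ.map q) i,
      (∀ r : ⨁ i, R Φ i, e (OreLocalization.oreDiv r 1) = R.mapRingHom q Φ r) ∧
      ∀ (n : ℤ) (z : OreLocalization S (⨁ i, R Φ i)),
        (∃ y : R (Φ.map q) n, e z = DirectSum.of (R (Φ.map q)) n y) ↔
          ∃ (i j : ℤ) (x : R Φ i) (s : R Φ j) (hs : DirectSum.of (R Φ) j s ∈ S),
            i - j = n ∧ z = OreLocalization.oreDiv (DirectSum.of (R Φ) i x)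
              (⟨DirectSum.of (R Φ) j s, hs⟩ : S)) ∧
    -- the vertical maps are continuous
    Continuous (rho Φ) ∧ Continuous (rho (Φ.map q)) ∧
    -- the bottom row
    Topology.IsEmbedding (Spech.comapR q Φ) ∧
    Set.range (Spech.comapR q Φ) = {p | p.Avoids (S : Set (⨁ i, R Φ i))} ∧
    -- the top row
    Topology.IsEmbedding (Z.comap q Φ) ∧
    Set.range (Z.comap q Φ) = {P | (rho Φ P).Avoids (S : Set (⨁ i, R Φ i))} ∧
    -- the square is commutative
    (∀ Q : Z (Φ.map q), rho Φ (Z.comap q Φ Q) = Spech.comapR q Φ (rho (Φ.map q) Q)) ∧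
    -- the square is cartesian
    Topology.IsEmbedding (fun Q : Z (Φ.map q) => (Z.comap q Φ Q, rho (Φ.map q) Q)) ∧
    Set.range (fun Q : Z (Φ.map q) => (Z.comap q Φ Q, rho (Φ.map q) Q)) =
      {x : Z Φ × Spech (R (Φ.map q)) | rho Φ x.1 = Spech.comapR q Φ x.2} := by
  have := (isThickTensorIdeal_thickTensorIdeal (conesOf (S : Set (⨁ i, R Φ i)))).triangulated
  have := Localization.essSurj q (thickTensorIdeal (conesOf (S : Set (⨁ i, R Φ i)))).trW
  have hbot := Spech.isEmbedding_comapR q hq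
  have htop : Topology.IsEmbedding (Z.comap q Φ) := Z.isEmbedding_comap q
  refine ⟨exists_localization_ringEquiv q S hS hq, continuous_rho Φ, continuous_rho (Φ.map q),
    hbot, Spech.range_comapR q hq, htop, Z.range_comap q hq, rho_comap q, ?_, ?_⟩
  -- The first component alone is already an embedding.
  · exact Topology.IsEmbedding.of_comp (htop.continuous.prodMk (continuous_rho _))
      continuous_fst htop
  · ext ⟨P, p⟩
    constructor
    · rintro ⟨Q, hQ⟩
      obtain ⟨rfl, rfl⟩ := Prod.mk.inj hQ
      exact rho_comap q Q
    · intro h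
      -- Since `rho Φ P` lies in the image of the bottom row, it avoids `S`, so `P` comes from some
      -- `Q`. Injectivity of the bottom row then identifies the image of `Q` with `p`.
      have hP : (rho Φ P).Avoids (S : Set (⨁ i, R Φ i)) := by
        rw [show rho Φ P = Spech.comapR q Φ p from h]
        exact (Spech.range_comapR q hq).subset ⟨p, rfl⟩
      obtain ⟨Q, rfl⟩ := (Z.range_comap q hq).superset hP
      exact ⟨Q, Prod.ext rfl (hbot.injective ((rho_comap q Q).symm.trans h))⟩
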